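/- Let $k>0$, let $\Omega\subset\mathbb R^3$ be a bounded domain (connected open set) with Lipschitz boundary, $\nu$ its outward unit normal (which exists at almost all boundary points), and let $D$ be an open set with $\overline D\subset\Omega$. Let $F\in L^2(\mathbb R^3)$ (complex valued) vanish almost everywhere outside $\overline D$, and let $w$ be the continuous function on $\mathbb R^3$ that satisfies $(\Delta+k^2)w+F=0$ in $\mathbb R^3$ in the sense of distributions together with the outgoing radiation condition $\lim_{r\to\infty}r\left(\frac{\partial}{\partial r}-ik\right)w(r\omega)=0$, uniformly in $\omega\in S^2$. Put $$K(z)=\frac{1}{4\pi}\frac{e^{ik|z|}}{|z|}\quad(z\neq 0),\qquad K_x(y)=K(y-x),$$ and, for $x\in\mathbb R^3\setminus\partial\Omega$, $$w'(x)=-\int_{\partial\Omega}\left(w\,\frac{\partial K_x}{\partial\nu}-K_x\,\frac{\partial w}{\partial\nu}\right)dS(y).$$ Let $\Psi$ be a complex-valued function of class $C^2$ with compact support on $\mathbb R^3$ such that $\Psi=w$ on $\partial\Omega$ and $\frac{\partial\Psi}{\partial\nu}=\frac{\partial w}{\partial\nu}$ at every point of $\partial\Omega$ at which $\nu$ exists.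 Then $$w'(x)=\begin{cases}\displaystyle\int_{\mathbb R^3\setminus\Omega}K(y-x)\,(\Delta+k^2)\Psi(y)\,dy, & x\in\Omega,\\[2mm] \displaystyle\int_{\Omega}K(y-x)\,(\Delta+k^2)\Psi(y)\,dy, & x\in\mathbb R^3\setminus\overline\Omega,\end{cases}$$ where all the integrals, including the one that defines $w'(x)$, converge absolutely. -/

import Mathlib

open MeasureTheory Filter Topology
open scoped InnerProductSpace Laplacian ContDiff NNReal

/-- Three-dimensional Euclidean space. -/
abbrev E3 : Type := EuclideanSpace ℝ (Fin 3)

/-- `n` is the outer unit normal of `Ω` at `x`: near `x`, up to an error `o(|y - x|)`, the set `Ω`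
is the half-space `{y | ⟪y - x, n⟫ < 0}`. For a domain with a `C¹` boundary (and at almost all
boundary points of a Lipschitz domain) this is the usual outer unit normal vector. -/
def IsOuterUnitNormal (Ω : Set E3) (x n : E3) : Prop :=
  ‖n‖ = 1 ∧ ∀ ε : ℝ, 0 < ε → ∀ᶠ y in 𝓝 x,
    (⟪y - x, n⟫_ℝ < -ε * ‖y - x‖ → y ∈ Ω) ∧ (ε * ‖y - x‖ < ⟪y - x, n⟫_ℝ → y ∉ Ω)

/-- The outer unit normal is unique, so that `outerNormal` below is well defined. -/
theorem IsOuterUnitNormal.unique {Ω : Set E3} {x n m : E3} (hn : IsOuterUnitNormal Ω x n)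
    (hm : IsOuterUnitNormal Ω x m) : n = m := by
  by_contra hne
  have hlt : ⟪n, m⟫_ℝ < 1 := inner_lt_one_iff_real_of_norm_eq_one hn.1 hm.1 |>.2 hne
  set c := 1 - ⟪n, m⟫_ℝ with hc
  have hcpos : 0 < c := by linarith
  have h1 : ⟪m - n, n⟫_ℝ = -c := by
    rw [inner_sub_left, real_inner_self_eq_norm_sq, hn.1, real_inner_comm]; simp [hc]
  have h2 : ⟪m - n, m⟫_ℝ = c := by
    rw [inner_sub_left, real_inner_self_eq_norm_sq, hm.1]; simp [hc]
  have hv : 0 < ‖m - n‖ := norm_pos_iff.2 (sub_ne_zero.2 (Ne.symm hne))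
  have hε : 0 < c / (2 * ‖m - n‖) := by positivity
  have ht : Tendsto (fun t : ℝ => x + t • (m - n)) (𝓝[>] 0) (𝓝 x) := by
    have : Continuous (fun t : ℝ => x + t • (m - n)) := by fun_prop
    simpa using (this.tendsto 0).mono_left nhdsWithin_le_nhds
  obtain ⟨t, ⟨ha, hb⟩, htpos⟩ := ((ht.eventually ((hn.2 _ hε).and (hm.2 _ hε))).and
    self_mem_nhdsWithin).exists
  have htp : 0 < t := htpos
  have key : c / (2 * ‖m - n‖) * (t * ‖m - n‖) = t * c / 2 := by field_simp
  have hnorm : ‖t • (m - n)‖ = t * ‖m - n‖ := by rw [norm_smul, Real.norm_of_nonneg htp.le]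
  simp only [add_sub_cancel_left, inner_smul_left, hnorm, h1, h2, neg_mul, key] at ha hb
  simp only [conj_trivial] at ha hb
  exact hb.2 (by nlinarith [mul_pos htp hcpos]) (ha.1 (by nlinarith [mul_pos htp hcpos]))

open Classical in
/-- The outer unit normal field of `Ω` (with the value `0` at points that have no normal). -/
noncomputable def outerNormal (Ω : Set E3) (x : E3) : E3 :=
  if h : ∃ n, IsOuterUnitNormal Ω x n then h.choose else 0

/-- A bounded domain with Lipschitz boundary: in a neighbourhood of each boundary point and in
suitable Cartesian coordinates, `Ω` is the region strictly below the graph of a Lipschitz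
function of two variables. -/
structure IsBoundedLipschitzDomain (Ω : Set E3) : Prop where
  isOpen : IsOpen Ω
  isConnected : IsConnected Ω
  isBounded : Bornology.IsBounded Ω
  locally_graph : ∀ x ∈ frontier Ω, ∃ U : Set E3, IsOpen U ∧ x ∈ U ∧
    ∃ (L : E3 ≃ₗᵢ[ℝ] E3) (φ : EuclideanSpace ℝ (Fin 2) → ℝ) (C : ℝ≥0), LipschitzWith C φ ∧
      ∀ y ∈ U, y ∈ Ω ↔ L y 2 < φ !₂[L y 0, L y 1]

/-- The surface measure on `∂Ω`: two-dimensional Hausdorff measure, normalized so that it agrees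
with the area on planes. -/
noncomputable def surfaceMeasure (Ω : Set E3) : Measure E3 :=
  (μHE[2] : Measure E3).restrict (frontier Ω)

/-- The outward normal derivative `∂f/∂ν` at a boundary point `y` of `Ω`. -/
noncomputable def normalDeriv (Ω : Set E3) (f : E3 → ℂ) (y : E3) : ℂ :=
  fderiv ℝ f y (outerNormal Ω y)

/-- `K(z) = e^{ik|z|} / (4π|z|)`, `z ≠ 0`. -/
noncomputable def helmholtzKernel (k : ℝ) (z : E3) : ℂ :=
  1 / (4 * Real.pi) * (Complex.exp (Complex.I * k * ‖z‖) / ‖z‖)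

/-- `w` is the (continuous representative of the) solution of `(Δ + k²) w + F = 0` in `ℝ³`, in the
sense of distributions, that satisfies the outgoing radiation condition
`r (∂/∂r - ik) w(rω) → 0` as `r = |x| → ∞`, uniformly in `ω = x / |x|`. -/
structure IsOutgoingSolution (k : ℝ) (F w : E3 → ℂ) : Prop where
  continuous : Continuous w
  weak_eq : ∀ φ : E3 → ℂ, ContDiff ℝ ∞ φ → HasCompactSupport φ →
    (∫ x, w x * (Δ φ x + (k : ℂ) ^ 2 * φ x)) + ∫ x, F x * φ x = 0
  radiation : Tendsto
    (fun x : E3 => (‖x‖ : ℂ) * (fderiv ℝ w x (‖x‖⁻¹ • x) - Complex.I * k * w x))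
    (Bornology.cobounded E3) (𝓝 0)

/-- The integrand `w ∂K_x/∂ν - K_x ∂w/∂ν`, where `K_x(y) = K(y - x)`. -/
noncomputable def surfaceIntegrand (k : ℝ) (Ω : Set E3) (w : E3 → ℂ) (x y : E3) : ℂ :=
  w y * normalDeriv Ω (fun z => helmholtzKernel k (z - x)) y
    - helmholtzKernel k (y - x) * normalDeriv Ω w y

/-- The field `w'(x) = - ∫_{∂Ω} (w ∂K_x/∂ν - K_x ∂w/∂ν) dS`. -/
noncomputable def cancellingField (k : ℝ) (Ω : Set E3) (w : E3 → ℂ) (x : E3) : ℂ :=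
  -∫ y, surfaceIntegrand k Ω w x y ∂(surfaceMeasure Ω)

/-- The integrand `K(y - x) (Δ + k²)Ψ(y)`. -/
noncomputable def volumeIntegrand (k : ℝ) (Ψ : E3 → ℂ) (x y : E3) : ℂ :=
  helmholtzKernel k (y - x) * (Δ Ψ y + (k : ℂ) ^ 2 * Ψ y)

/-!
On `∂Ω` the functions `Ψ` and `w` have the same Cauchy data, so `w` may be replaced by `Ψ` in the
surface integral that defines `w'`. A cutoff that vanishes near the pole `x` turns `K_x` into a
smooth function `κ` on the whole space.

* If `x ∉ closure Ω`, one can take `κ = K_x` near `closure Ω`, and Green's second identity in `Ω`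
  for `Ψ` and `κ` is the claim, since `(Δ + k²) K_x = 0` in `Ω`.
* If `x ∈ Ω`, one can take `κ = K_x` near the complement of `Ω`. Both sides then vanish. The
  integral of `Ψ Δκ - κ ΔΨ` over the whole space is zero because `Ψ` has compact support, and
  over `Ω` it is `-w'(x)` by Green's identity, so the volume integral over the complement is
  `-w'(x)`. On the other hand `w` is smooth off `closure D` and solves the Helmholtz equation there,
  so that `-w'(x)` is also the flux of `w ∇K_x - K_x ∇w` at infinity, which the radiation condition
  makes zero (`IsOutgoingSolution.integral_surfaceIntegrand_eq_zero`).

Four ingredients carry this.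

* Green's identity on a Lipschitz domain (`IsBoundedLipschitzDomain.green`). It follows by a
  partition of unity from the divergence theorem below the graph of a Lipschitz function `φ`, where
  the shear `(u, t) ↦ (u, φ u + t)` preserves volume and turns it into the one-dimensional
  fundamental theorem of calculus and the vanishing of `∫ ∂(f ∘ graph)`. Rademacher's theorem and
  the area formula `LipschitzWith.comap_graphMap_euclideanHausdorffMeasure` identify the result
  with an integral over Hausdorff measure. The area formula holds because `φ` is, on countably many
  pieces, close to linear functions, for which it is linear algebra.
* The regularized kernels `e^{iks} / s` with `s = (|y|² + a)^{1/2}`, `a > 0`, are smooth, and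
  `Δ + k²` maps them to an approximate identity as `a → 0`. Testing the weak equation with
  truncations of them exhibits `w`, off the support of `F`, as a convolution with a smooth kernel
  (`weak_helmholtz_mean_value`), hence `w` is smooth there (`weak_helmholtz_contDiffAt`).
* `laplacian_helmholtzKernel` is the case `a = 0` of the same computation.
* The radiation condition says nothing about the size of `w` itself. Conservation of the flux
  `Im ∫ w̄ ∂w/∂r` over large spheres bounds the mean square of `w` over them
  (`exists_integral_radialCutoffSlope_norm_sq_le`), and this suffices to make the flux of
  `w ∇K_x - K_x ∇w` tend to zero (`integral_green_eq_zero_of_outgoing`). Integrals over spheres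
  enter only through their averages over the radius, against the gradient of a smooth radial cutoff.
-/

/-! ### Lipschitz graphs and their area -/

/-- The Euclidean plane, which parametrizes the graphs that describe the boundary. -/
abbrev E2 : Type := EuclideanSpace ℝ (Fin 2)

/-- The linear coordinates `(u, z) ↦ (u₀, u₁, z)` on three-dimensional space. -/
noncomputable def coordEquiv : (E2 × ℝ) ≃L[ℝ] E3 :=
  LinearEquiv.toContinuousLinearEquiv
    { toFun := fun p => !₂[p.1 0, p.1 1, p.2]
      invFun := fun y => (!₂[y 0, y 1], y 2)
      map_add' := fun p q => by ext i; fin_cases i <;> simp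
      map_smul' := fun c p => by ext i; fin_cases i <;> simp
      left_inv := fun p => by
        ext i
        · fin_cases i <;> simp
        · simp
      right_inv := fun y => by ext i; fin_cases i <;> simp }

theorem coordEquiv_apply (p : E2 × ℝ) : coordEquiv p = !₂[p.1 0, p.1 1, p.2] := rfl

theorem norm_sq_coordEquiv (p : E2 × ℝ) : ‖coordEquiv p‖ ^ 2 = ‖p.1‖ ^ 2 + p.2 ^ 2 := by
  rw [coordEquiv_apply, EuclideanSpace.norm_sq_eq, EuclideanSpace.norm_sq_eq, Fin.sum_univ_three,
    Fin.sum_univ_two]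
  simp

theorem norm_fst_le_norm_coordEquiv (p : E2 × ℝ) : ‖p.1‖ ≤ ‖coordEquiv p‖ := by
  apply le_of_sq_le_sq _ (norm_nonneg _)
  rw [norm_sq_coordEquiv]
  nlinarith [sq_nonneg p.2]

theorem norm_coordEquiv_zero_left (z : ℝ) : ‖coordEquiv (0, z)‖ = |z| := by
  have := norm_sq_coordEquiv (0, z)
  simp only [norm_zero] at this
  rw [← Real.sqrt_sq (norm_nonneg _), this, ← Real.sqrt_sq_eq_abs]
  simp

/-- The density of surface area on a graph with the differential `ℓ`. -/
noncomputable def areaDensity (ℓ : E2 →L[ℝ] ℝ) : ℝ :=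
  √(1 + (ℓ (EuclideanSpace.single 0 1)) ^ 2 + (ℓ (EuclideanSpace.single 1 1)) ^ 2)

theorem one_le_areaDensity (ℓ : E2 →L[ℝ] ℝ) : 1 ≤ areaDensity ℓ := by
  unfold areaDensity
  rw [Real.one_le_sqrt]
  nlinarith [sq_nonneg (ℓ (EuclideanSpace.single 0 1)), sq_nonneg (ℓ (EuclideanSpace.single 1 1))]

theorem continuous_areaDensity : Continuous areaDensity := by
  unfold areaDensity
  fun_prop

/-- The parametrization of the graph of `φ`. -/
noncomputable def graphMap (φ : E2 → ℝ) (u : E2) : E3 := coordEquiv (u, φ u)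

theorem graphMap_sub_graphMap (φ : E2 → ℝ) (u v : E2) :
    graphMap φ u - graphMap φ v = coordEquiv (u - v, φ u - φ v) := by
  rw [graphMap, graphMap, ← map_sub]; rfl

theorem dist_le_dist_graphMap (φ : E2 → ℝ) (u v : E2) :
    dist u v ≤ dist (graphMap φ u) (graphMap φ v) := by
  rw [dist_eq_norm, dist_eq_norm, graphMap_sub_graphMap]
  exact norm_fst_le_norm_coordEquiv (u - v, φ u - φ v)

theorem graphMap_injective (φ : E2 → ℝ) : Function.Injective (graphMap φ) := fun u v h => by
  have := dist_le_dist_graphMap φ u v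
  rw [h, dist_self] at this
  exact dist_le_zero.1 this

theorem LipschitzWith.continuous_graphMap {φ : E2 → ℝ} {C : ℝ≥0} (hφ : LipschitzWith C φ) :
    Continuous (graphMap φ) :=
  coordEquiv.continuous.comp (continuous_id.prodMk hφ.continuous)

theorem LipschitzWith.measurableEmbedding_graphMap {φ : E2 → ℝ} {C : ℝ≥0}
    (hφ : LipschitzWith C φ) : MeasurableEmbedding (graphMap φ) :=
  hφ.continuous_graphMap.measurableEmbedding (graphMap_injective φ)

/-- The image of a planar set under a linear graph has the area given by `areaDensity`. -/
theorem euclideanHausdorffMeasure_image_graphMap_linear (ℓ : E2 →L[ℝ] ℝ) (s : Set E2) :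
    μHE[2] (graphMap ℓ '' s) = ENNReal.ofReal (areaDensity ℓ) * volume s := by
  let G : E2 →ₗ[ℝ] E3 := coordEquiv.toLinearMap ∘ₗ (LinearMap.id.prod ℓ.toLinearMap)
  have hG : ∀ u, G u = graphMap ℓ u := fun u => rfl
  have hdet : G.normDet = areaDensity ℓ := by
    have h := G.normDet_sq_eq_det_gram (EuclideanSpace.basisFun (Fin 2) ℝ)
    rw [Matrix.det_fin_two] at h
    simp only [Matrix.gram_apply, hG, graphMap, coordEquiv_apply, EuclideanSpace.basisFun_apply,
      PiLp.inner_apply, Fin.sum_univ_three] at h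
    rw [areaDensity, ← Real.sqrt_sq G.normDet_nonneg]
    congr 1
    simp at h
    rw [h]; ring
  have := G.euclideanHausdorffMeasure_image_eq_normDet_mul_volume s
  rw [hdet, finrank_euclideanSpace_fin] at this
  exact this

/-- The hypothesis makes the correspondence `g u ↦ f u` a well-defined Lipschitz map. -/
theorem euclideanHausdorffMeasure_image_le_of_dist_le {α X Y : Type*} [MetricSpace X]
    [MetricSpace Y] [MeasurableSpace X] [BorelSpace X] [MeasurableSpace Y] [BorelSpace Y]
    {f : α → Y} {g : α → X} {s : Set α} {K : ℝ≥0}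
    (h : ∀ u ∈ s, ∀ v ∈ s, dist (f u) (f v) ≤ K * dist (g u) (g v)) (d : ℕ) :
    μHE[d] (f '' s) ≤ (K : ENNReal) ^ d * μHE[d] (g '' s) := by
  rcases s.eq_empty_or_nonempty with rfl | ⟨a, ha⟩
  · simp
  have : Nonempty α := ⟨a⟩
  set F : X → Y := fun y => f (Function.invFunOn g s y) with hF
  have hmem : ∀ u ∈ s, Function.invFunOn g s (g u) ∈ s ∧ g (Function.invFunOn g s (g u)) = g u :=
    fun u hu => ⟨Function.invFunOn_mem ⟨u, hu, rfl⟩, Function.invFunOn_eq ⟨u, hu, rfl⟩⟩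
  have hLip : LipschitzOnWith K F (g '' s) := by
    refine LipschitzOnWith.of_dist_le_mul ?_
    rintro _ ⟨u, hu, rfl⟩ _ ⟨v, hv, rfl⟩
    have := h _ (hmem u hu).1 _ (hmem v hv).1
    rwa [(hmem u hu).2, (hmem v hv).2] at this
  have himg : f '' s = F '' (g '' s) := by
    rw [Set.image_image]
    refine Set.image_congr fun u hu => ?_
    have := h u hu _ (hmem u hu).1
    rw [(hmem u hu).2, dist_self, mul_zero] at this
    exact dist_le_zero.1 this
  rw [himg]
  have hH := hLip.hausdorffMeasure_image_le (d := d) (by positivity)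
  rw [ENNReal.rpow_natCast] at hH
  simp only [Measure.euclideanHausdorffMeasure_def, Measure.smul_apply, ENNReal.smul_def,
    smul_eq_mul]
  rw [mul_left_comm]
  gcongr

theorem dist_graphMap_le_of_abs_sub_le {φ ψ : E2 → ℝ} {ε : ℝ≥0} {u v : E2}
    (h : |φ u - φ v - (ψ u - ψ v)| ≤ ε * ‖u - v‖) :
    dist (graphMap φ u) (graphMap φ v) ≤ (1 + ε : ℝ≥0) * dist (graphMap ψ u) (graphMap ψ v) := by
  have h1 := dist_le_dist_graphMap ψ u v
  have h2 : graphMap φ u - graphMap φ v = (graphMap ψ u - graphMap ψ v)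
      + coordEquiv (0, φ u - φ v - (ψ u - ψ v)) := by
    rw [graphMap_sub_graphMap, graphMap_sub_graphMap, ← map_add]
    congr 1
    ext <;> simp
  rw [dist_eq_norm, h2]
  refine (norm_add_le _ _).trans ?_
  rw [norm_coordEquiv_zero_left, ← dist_eq_norm]
  rw [← dist_eq_norm] at h
  push_cast
  nlinarith [mul_le_mul_of_nonneg_left h1 ε.2, show (0:ℝ) ≤ ε from ε.2]

/-- A comparison of two measures on the pieces of a countable cover holds globally. -/
theorem measure_le_mul_of_cover {α : Type*} [MeasurableSpace α] {μ ν : Measure α} {K : ENNReal}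
    {P : ℕ → Set α} (hP : ∀ i, MeasurableSet (P i)) {A : Set α} (hA : MeasurableSet A)
    (hAP : A ⊆ ⋃ i, P i)
    (h : ∀ i, ∀ s, MeasurableSet s → s ⊆ A ∩ P i → ν s ≤ K * μ s) : ν A ≤ K * μ A := by
  have hd : Pairwise (Function.onFun Disjoint fun i => A ∩ disjointed P i) :=
    fun i j hij => ((disjoint_disjointed P) hij).mono Set.inter_subset_right Set.inter_subset_right
  have hm : ∀ i, MeasurableSet (A ∩ disjointed P i) :=
    fun i => hA.inter (MeasurableSet.disjointed hP i)
  have hU : A = ⋃ i, A ∩ disjointed P i := by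
    rw [← Set.inter_iUnion, iUnion_disjointed, Set.inter_eq_left.2 hAP]
  rw [hU, measure_iUnion hd hm, measure_iUnion hd hm, ← ENNReal.tsum_mul_left]
  exact ENNReal.tsum_le_tsum fun i =>
    h i _ (hm i) (Set.inter_subset_inter_right _ (disjointed_subset _ _))

/-- The area formula for the graph of a Lipschitz function of two variables. -/
theorem LipschitzWith.comap_graphMap_euclideanHausdorffMeasure {φ : E2 → ℝ} {C : ℝ≥0}
    (hφ : LipschitzWith C φ) :
    (μHE[2] : Measure E3).comap (graphMap φ) =
      volume.withDensity (fun u => ENNReal.ofReal (areaDensity (fderiv ℝ φ u))) := by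
  set ν := (μHE[2] : Measure E3).comap (graphMap φ) with hν
  set J : E2 → ℝ := fun u => areaDensity (fderiv ℝ φ u) with hJ
  have hJm : Measurable J := continuous_areaDensity.measurable.comp (measurable_fderiv ℝ φ)
  set μ := (volume : Measure E2).withDensity (fun u => ENNReal.ofReal (J u)) with hμ
  have hνa : ∀ s, ν s = μHE[2] (graphMap φ '' s) :=
    fun s => hφ.measurableEmbedding_graphMap.comap_apply _ s
  set N : Set E2 := {u | DifferentiableAt ℝ φ u} with hN
  have hNm : MeasurableSet N := measurableSet_of_differentiableAt ℝ φ
  have hNvol : volume Nᶜ = 0 := hφ.ae_differentiableAt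
  have hNμ : μ Nᶜ = 0 := withDensity_absolutelyContinuous _ _ hNvol
  have hNν : ν Nᶜ = 0 := by
    have h := euclideanHausdorffMeasure_image_le_of_dist_le (f := graphMap φ)
      (g := graphMap (0 : E2 →L[ℝ] ℝ)) (s := Nᶜ) (K := 1 + C) (fun u _ v _ => by
        apply dist_graphMap_le_of_abs_sub_le
        have := hφ.dist_le_mul u v
        rw [Real.dist_eq, dist_eq_norm] at this
        simpa using this) 2
    rw [euclideanHausdorffMeasure_image_graphMap_linear, hNvol, mul_zero, mul_zero] at h
    rw [hνa]
    exact le_antisymm h zero_le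
  -- It suffices to compare the two measures up to the factor `c ^ 3`, for every `c > 1`.
  have key : ∀ c : ℝ≥0, 1 < c → ∀ A, MeasurableSet A → A ⊆ N →
      ν A ≤ (c : ENNReal) ^ 3 * μ A ∧ μ A ≤ (c : ENNReal) ^ 3 * ν A := by
    intro c hc A hA hAN
    set P : ℕ → Set E2 := fun m => J ⁻¹' (Set.Ico ((c : ℝ) ^ m) ((c : ℝ) ^ (m + 1))) with hPdef
    have hP : ∀ m, MeasurableSet (P m) := fun m => hJm measurableSet_Ico
    -- The lower bound `1` of the density makes nonnegative powers of `c` suffice.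
    have hAP : A ⊆ ⋃ m, P m := fun u _ => by
      obtain ⟨m, hm⟩ := exists_nat_pow_near (one_le_areaDensity (fderiv ℝ φ u))
        (show (1 : ℝ) < c by exact_mod_cast hc)
      exact Set.mem_iUnion.2 ⟨m, hm⟩
    -- On a piece where the density varies by a factor `c` at most and `φ` is almost linear:
    -- replacing `φ` by `ℓ` changes lengths by a factor `c`, hence areas by `c ^ 2`.
    have small : ∀ m s ℓ, MeasurableSet s → s ⊆ P m → (areaDensity ℓ ∈ Set.Ico ((c : ℝ) ^ m)
        ((c : ℝ) ^ (m + 1))) → ApproximatesLinearOn φ ℓ s (c - 1) →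
        ν s ≤ (c : ENNReal) ^ 3 * μ s ∧ μ s ≤ (c : ENNReal) ^ 3 * ν s := by
      intro m s ℓ hs hsP hℓ happ
      have hc1 : 1 + (c - 1) = c := add_tsub_cancel_of_le hc.le
      have e1 : ν s ≤ (c : ENNReal) ^ 2 * (ENNReal.ofReal (areaDensity ℓ) * volume s) := by
        rw [hνa, ← euclideanHausdorffMeasure_image_graphMap_linear, ← hc1]
        refine euclideanHausdorffMeasure_image_le_of_dist_le (fun u hu v hv => ?_) 2
        apply dist_graphMap_le_of_abs_sub_le
        have := happ u hu v hv
        rwa [map_sub, Real.norm_eq_abs] at this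
      have e2 : ENNReal.ofReal (areaDensity ℓ) * volume s ≤ (c : ENNReal) ^ 2 * ν s := by
        rw [hνa, ← euclideanHausdorffMeasure_image_graphMap_linear, ← hc1]
        refine euclideanHausdorffMeasure_image_le_of_dist_le (fun u hu v hv => ?_) 2
        apply dist_graphMap_le_of_abs_sub_le
        have := happ u hu v hv
        rwa [map_sub, Real.norm_eq_abs, abs_sub_comm] at this
      have e3 : ENNReal.ofReal ((c : ℝ) ^ m) * volume s ≤ μ s := by
        rw [hμ, withDensity_apply _ hs, ← setLIntegral_const]
        exact setLIntegral_mono' hs fun u hu => ENNReal.ofReal_le_ofReal (hsP hu).1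
      have e4 : μ s ≤ ENNReal.ofReal ((c : ℝ) ^ (m + 1)) * volume s := by
        rw [hμ, withDensity_apply _ hs, ← setLIntegral_const]
        exact setLIntegral_mono' hs fun u hu => ENNReal.ofReal_le_ofReal (hsP hu).2.le
      have e5 : ENNReal.ofReal ((c : ℝ) ^ (m + 1)) = c * ENNReal.ofReal ((c : ℝ) ^ m) := by
        rw [pow_succ', ENNReal.ofReal_mul (by positivity), ENNReal.ofReal_coe_nnreal]
      have e6 := ENNReal.ofReal_le_ofReal hℓ.1
      have e7 := ENNReal.ofReal_le_ofReal hℓ.2.le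
      rw [e5] at e4 e7
      constructor
      · calc ν s ≤ (c : ENNReal) ^ 2 * (ENNReal.ofReal (areaDensity ℓ) * volume s) := e1
          _ ≤ (c : ENNReal) ^ 2 * (c * ENNReal.ofReal ((c : ℝ) ^ m) * volume s) := by gcongr
          _ = (c : ENNReal) ^ 3 * (ENNReal.ofReal ((c : ℝ) ^ m) * volume s) := by ring
          _ ≤ _ := by gcongr
      · calc μ s ≤ c * ENNReal.ofReal ((c : ℝ) ^ m) * volume s := e4
          _ ≤ c * (ENNReal.ofReal (areaDensity ℓ) * volume s) := by rw [mul_assoc]; gcongr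
          _ ≤ c * ((c : ENNReal) ^ 2 * ν s) := by gcongr
          _ = _ := by ring
    have part : ∀ m s, MeasurableSet s → s ⊆ A ∩ P m →
        ν s ≤ (c : ENNReal) ^ 3 * μ s ∧ μ s ≤ (c : ENNReal) ^ 3 * ν s := by
      intro m s hs hsP
      rcases s.eq_empty_or_nonempty with rfl | hne
      · simp
      obtain ⟨t, ℓ, -, htm, hst, happ, hℓ⟩ :=
        exists_partition_approximatesLinearOn_of_hasFDerivWithinAt φ s (fderiv ℝ φ)
        (fun u hu => (hAN (hsP hu).1).hasFDerivAt.hasFDerivWithinAt) (fun _ => c - 1)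
        (fun _ => (tsub_pos_of_lt hc).ne')
      have h' : ∀ i r, MeasurableSet r → r ⊆ s ∩ t i →
          ν r ≤ (c : ENNReal) ^ 3 * μ r ∧ μ r ≤ (c : ENNReal) ^ 3 * ν r := by
        intro i r hr hrs
        obtain ⟨y, hy, hyℓ⟩ := hℓ hne i
        refine small m r (ℓ i) hr (fun u hu => (hsP (hrs hu).1).2) ?_ ((happ i).mono_set hrs)
        rw [hyℓ]
        exact (hsP hy).2
      exact ⟨measure_le_mul_of_cover htm hs hst fun i r hr hrs => (h' i r hr hrs).1,
        measure_le_mul_of_cover htm hs hst fun i r hr hrs => (h' i r hr hrs).2⟩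
    exact ⟨measure_le_mul_of_cover hP hA hAP fun i r hr hrs => (part i r hr hrs).1,
      measure_le_mul_of_cover hP hA hAP fun i r hr hrs => (part i r hr hrs).2⟩
  have hlim : ∀ x y : ENNReal, (∀ c : ℝ≥0, 1 < c → x ≤ (c : ENNReal) ^ 3 * y) → x ≤ y := by
    intro x y h
    have ht : Tendsto (fun c : ℝ≥0 => (c : ENNReal) ^ 3 * y) (𝓝[>] 1) (𝓝 (1 * y)) := by
      refine ENNReal.Tendsto.mul_const ?_ (Or.inl one_ne_zero)
      have : Continuous fun c : ℝ≥0 => (c : ENNReal) ^ 3 :=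
        (ENNReal.continuous_pow 3).comp ENNReal.continuous_coe
      simpa using (this.tendsto 1).mono_left nhdsWithin_le_nhds
    rw [one_mul] at ht
    exact ge_of_tendsto ht (eventually_nhdsWithin_of_forall h)
  refine Measure.ext fun s hs => ?_
  have hs1 : ν s = ν (s ∩ N) := by
    rw [← measure_inter_add_sdiff s hNm, measure_mono_null (fun u hu => hu.2 : s \ N ⊆ Nᶜ) hNν,
      add_zero]
  have hs2 : μ s = μ (s ∩ N) := by
    rw [← measure_inter_add_sdiff s hNm, measure_mono_null (fun u hu => hu.2 : s \ N ⊆ Nᶜ) hNμ,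
      add_zero]
  rw [hs1, hs2]
  have hk := fun c hc => key c hc (s ∩ N) (hs.inter hNm) Set.inter_subset_right
  exact le_antisymm (hlim _ _ fun c hc => (hk c hc).1) (hlim _ _ fun c hc => (hk c hc).2)

/-! ### The divergence theorem below a Lipschitz graph -/

theorem measurePreserving_coordEquiv : MeasurePreserving coordEquiv := by
  have h1 : MeasurePreserving (fun y : E3 => (WithLp.ofLp y : Fin 3 → ℝ)) :=
    PiLp.volume_preserving_ofLp (Fin 3)
  have h2 := volume_preserving_piFinSuccAbove (fun _ : Fin 3 => ℝ) 2
  have h3 : MeasurePreserving (Prod.map (id : ℝ → ℝ) (WithLp.toLp 2 : (Fin 2 → ℝ) → E2)) :=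
    (MeasurePreserving.id volume).prod (PiLp.volume_preserving_toLp (Fin 2))
  have h4 : MeasurePreserving (Prod.swap : ℝ × E2 → E2 × ℝ) := Measure.measurePreserving_swap
  have h := (h4.comp h3).comp (h2.comp h1)
  have he : ((Prod.swap : ℝ × E2 → E2 × ℝ) ∘ (Prod.map (id : ℝ → ℝ)
      (WithLp.toLp 2 : (Fin 2 → ℝ) → E2))) ∘ (MeasurableEquiv.piFinSuccAbove
      (fun _ : Fin 3 => ℝ) 2) ∘ (fun y : E3 => (WithLp.ofLp y : Fin 3 → ℝ)) =
      coordEquiv.symm := by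
    funext y
    ext i
    · fin_cases i <;> rfl
    · rfl
  rw [he] at h
  exact h.symm coordEquiv.toHomeomorph.symm.toMeasurableEquiv

/-- The homeomorphism `(u, t) ↦ (u, φ u + t)` that flattens the graph of `φ` to `t = 0`. -/
noncomputable def shear (φ : E2 → ℝ) (hφ : Continuous φ) : (E2 × ℝ) ≃ₜ E3 :=
  Homeomorph.trans
    { toFun := fun p => (p.1, φ p.1 + p.2)
      invFun := fun p => (p.1, p.2 - φ p.1)
      left_inv := fun p => by simp
      right_inv := fun p => by simp
      continuous_toFun := by fun_prop
      continuous_invFun := by fun_prop }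
    coordEquiv.toHomeomorph

theorem shear_apply (φ : E2 → ℝ) (hφ : Continuous φ) (p : E2 × ℝ) :
    shear φ hφ p = coordEquiv (p.1, φ p.1 + p.2) := rfl

theorem measurePreserving_shear (φ : E2 → ℝ) (hφ : Continuous φ) :
    MeasurePreserving (shear φ hφ) := by
  refine measurePreserving_coordEquiv.comp ?_
  refine (MeasurePreserving.id volume).skew_product (g := fun u t => φ u + t)
    (by fun_prop) (Eventually.of_forall fun u => ?_)
  exact (measurePreserving_add_left volume (φ u)).map_eq

/-- The region strictly below the graph of `φ`. -/
def subgraph (φ : E2 → ℝ) : Set E3 := {y | y 2 < φ !₂[y 0, y 1]}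

theorem shear_preimage_subgraph {φ : E2 → ℝ} (hφ : Continuous φ) :
    shear φ hφ ⁻¹' subgraph φ = Prod.snd ⁻¹' Set.Iio 0 := by
  ext p
  have : (!₂[p.1 0, p.1 1] : E2) = p.1 := by ext i; fin_cases i <;> rfl
  simp [subgraph, shear_apply, coordEquiv_apply, this]

theorem LipschitzWith.isClosedEmbedding_graphMap {φ : E2 → ℝ} {C : ℝ≥0} (hφ : LipschitzWith C φ) :
    IsClosedEmbedding (graphMap φ) := by
  have h1 : AntilipschitzWith 1 (graphMap φ) :=
    AntilipschitzWith.of_le_mul_dist fun u v => by simpa using dist_le_dist_graphMap φ u v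
  have h2 : UniformContinuous (graphMap φ) :=
    coordEquiv.toContinuousLinearMap.uniformContinuous.comp
      (uniformContinuous_id.prodMk hφ.uniformContinuous)
  exact h1.isClosedEmbedding h2

theorem LipschitzWith.exists_lipschitzWith_graphMap {φ : E2 → ℝ} {C : ℝ≥0}
    (hφ : LipschitzWith C φ) : ∃ D, LipschitzWith D (graphMap φ) :=
  ⟨_, coordEquiv.toContinuousLinearMap.lipschitz.comp (LipschitzWith.id.prodMk hφ)⟩

/-- The integral of a partial derivative of a compactly supported Lipschitz function vanishes. -/
theorem LipschitzWith.integral_lineDeriv_eq_zero {g : E2 → ℝ} {C : ℝ≥0} (hg : LipschitzWith C g)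
    (hgc : HasCompactSupport g) (v : E2) : ∫ u, lineDeriv ℝ g u v = 0 := by
  have h := LipschitzWith.integral_lineDeriv_mul_eq (μ := volume)
    (LipschitzWith.const (1 : ℝ) (α := E2)) hg hgc (-v)
  simpa [lineDeriv] using h.symm

/-- The integral of a tangential derivative along the graph vanishes, because it is a partial
derivative of the Lipschitz function `f ∘ graphMap φ`. -/
theorem LipschitzWith.integral_fderiv_graphMap_eq_zero {φ : E2 → ℝ} {C : ℝ≥0}
    (hφ : LipschitzWith C φ) {f : E3 → ℝ} (hf : ContDiff ℝ 1 f) (hfc : HasCompactSupport f)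
    (v : E2) : ∫ u, fderiv ℝ f (graphMap φ u) (coordEquiv (v, fderiv ℝ φ u v)) = 0 := by
  obtain ⟨D, hD⟩ := hφ.exists_lipschitzWith_graphMap
  obtain ⟨D', hD'⟩ := hf.lipschitzWith_of_hasCompactSupport hfc one_ne_zero
  rw [← (hD'.comp hD).integral_lineDeriv_eq_zero
    (hfc.comp_isClosedEmbedding hφ.isClosedEmbedding_graphMap) v]
  refine integral_congr_ae ?_
  filter_upwards [hφ.ae_differentiableAt] with u hu
  have h1 : HasFDerivAt (graphMap φ)
      (coordEquiv.toContinuousLinearMap ∘L ((ContinuousLinearMap.id ℝ E2).prod (fderiv ℝ φ u))) u :=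
    coordEquiv.toContinuousLinearMap.hasFDerivAt.comp u ((hasFDerivAt_id u).prodMk hu.hasFDerivAt)
  have h2 := ((hf.differentiable one_ne_zero) (graphMap φ u)).hasFDerivAt.comp u h1
  rw [(h2.hasLineDerivAt v).lineDeriv]
  rfl

/-- The divergence theorem for a vector field of constant direction on the region below the graph
of a Lipschitz function. -/
theorem LipschitzWith.integral_subgraph_fderiv {φ : E2 → ℝ} {C : ℝ≥0}
    (hφ : LipschitzWith C φ) {f : E3 → ℝ} (hf : ContDiff ℝ 1 f) (hfc : HasCompactSupport f)
    (e : E3) :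
    ∫ y in subgraph φ, fderiv ℝ f y e =
      ∫ u, f (graphMap φ u) * (e 2 - fderiv ℝ φ u !₂[e 0, e 1]) := by
  set v : E2 := !₂[e 0, e 1] with hv
  set T := shear φ hφ.continuous with hT
  have hTm : MeasurePreserving T := measurePreserving_shear φ hφ.continuous
  have he : e = coordEquiv (v, 0) + e 2 • coordEquiv (0, 1) := by
    ext i; fin_cases i <;> simp [coordEquiv_apply, hv]
  have hcd : ∀ d : E3, Continuous fun p => fderiv ℝ f (T p) d := fun d =>
    ((hf.continuous_fderiv one_ne_zero).clm_apply continuous_const).comp T.continuous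
  have hcs : ∀ d : E3, HasCompactSupport fun p => fderiv ℝ f (T p) d := fun d =>
    (hfc.fderiv_apply (𝕜 := ℝ) d).comp_homeomorph T
  have hint : ∀ d : E3, Integrable (fun p : E2 × ℝ => fderiv ℝ f (T p) d)
      (volume.prod (volume.restrict (Set.Iio 0))) := fun d => by
    have h := (hcd d).integrable_of_hasCompactSupport (hcs d) (μ := (volume : Measure (E2 × ℝ)))
    rw [← Measure.restrict_univ (μ := (volume : Measure E2)), Measure.prod_restrict]
    exact h.integrableOn
  set A : E2 × ℝ → ℝ := fun p => fderiv ℝ f (T p) (coordEquiv (v, 0)) with hA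
  set B : E2 × ℝ → ℝ := fun p => fderiv ℝ f (T p) (coordEquiv (0, 1)) with hB
  have hslope : ∀ u, ‖fderiv ℝ φ u v‖ ≤ C * ‖v‖ := fun u =>
    (fderiv ℝ φ u).le_of_opNorm_le (norm_fderiv_le_of_lipschitz ℝ hφ) v
  have hslopem : Measurable fun u => fderiv ℝ φ u v := measurable_fderiv_apply_const ℝ φ v
  have hintB : Integrable (fun p : E2 × ℝ => fderiv ℝ φ p.1 v * B p)
      (volume.prod (volume.restrict (Set.Iio 0))) :=
    (hint _).bdd_mul (c := C * ‖v‖) (hslopem.comp measurable_fst).aestronglyMeasurable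
      (Eventually.of_forall fun p => hslope p.1)
  -- On vertical lines: the fundamental theorem of calculus.
  have hvert : ∀ u, ∫ t in Set.Iio 0, B (u, t) = f (graphMap φ u) := by
    intro u
    have hd : ∀ t : ℝ, HasDerivAt (fun t => f (T (u, t))) (B (u, t)) t := by
      intro t
      have h1 : HasDerivAt (fun t : ℝ => ((0 : E2), t)) (0, 1) t :=
        (hasDerivAt_const t (0 : E2)).prodMk (hasDerivAt_id t)
      have h2 : HasDerivAt (fun t : ℝ => T (u, t)) (coordEquiv (0, 1)) t := by
        have h3 := (coordEquiv.toContinuousLinearMap.hasFDerivAt.comp_hasDerivAt t h1).const_add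
          (coordEquiv (u, φ u))
        refine h3.congr_of_eventuallyEq (Eventually.of_forall fun s => ?_)
        change coordEquiv (u, φ u + s) = coordEquiv (u, φ u) + coordEquiv (0, s)
        rw [← map_add]; congr 1; ext <;> simp
      exact ((hf.differentiable one_ne_zero) _).hasFDerivAt.comp_hasDerivAt t h2
    have hemb : IsClosedEmbedding fun t : ℝ => T (u, t) :=
      T.isClosedEmbedding.comp ⟨isEmbedding_prodMkRight u, by
        have : Set.range (Prod.mk u : ℝ → E2 × ℝ) = {u} ×ˢ Set.univ := by
          ext ⟨a, b⟩; simp [eq_comm]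
        rw [this]; exact isClosed_singleton.prod isClosed_univ⟩
    have hc1 : HasCompactSupport fun t => f (T (u, t)) := hfc.comp_isClosedEmbedding hemb
    have hlim : Tendsto (fun t => f (T (u, t))) atBot (𝓝 0) :=
      (hc1.is_zero_at_infty).mono_left atBot_le_cocompact
    have hBi : IntegrableOn (fun t => B (u, t)) (Set.Iic 0) := by
      refine (Continuous.integrable_of_hasCompactSupport ?_ ?_).integrableOn
      · exact (hcd _).comp (by fun_prop)
      · exact (hfc.fderiv_apply (𝕜 := ℝ) _).comp_isClosedEmbedding hemb
    rw [← integral_Iic_eq_integral_Iio,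
      integral_Iic_of_hasDerivAt_of_tendsto' (fun t _ => hd t) hBi hlim, sub_zero, hT, shear_apply]
    simp [graphMap]
  -- On each translate `t + φ` of the graph, a horizontal derivative is a tangential one minus the
  -- slope times the vertical one.
  have hhor : ∀ t, ∫ u, A (u, t) = -∫ u, fderiv ℝ φ u v * B (u, t) := by
    intro t
    have hφt : LipschitzWith C fun u => φ u + t := fun u v => by
      simpa [edist_add_right] using hφ u v
    have h := hφt.integral_fderiv_graphMap_eq_zero hf hfc v
    have hfd : ∀ u, fderiv ℝ (fun u => φ u + t) u = fderiv ℝ φ u := fun u => fderiv_add_const t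
    have hemb : IsClosedEmbedding fun u : E2 => T (u, t) := hφt.isClosedEmbedding_graphMap
    have hi : ∀ d, Integrable fun u => fderiv ℝ f (T (u, t)) d := fun d =>
      ((hcd d).comp (by fun_prop)).integrable_of_hasCompactSupport
        ((hfc.fderiv_apply (𝕜 := ℝ) d).comp_isClosedEmbedding hemb)
    have hi2 : Integrable fun u => fderiv ℝ φ u v * B (u, t) :=
      (hi _).bdd_mul (c := C * ‖v‖) hslopem.aestronglyMeasurable (Eventually.of_forall hslope)
    rw [eq_neg_iff_add_eq_zero, ← integral_add (hi _) hi2]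
    refine (integral_congr_ae (Eventually.of_forall fun u => ?_)).trans h
    have h3 : coordEquiv (v, fderiv ℝ φ u v) =
        coordEquiv (v, 0) + fderiv ℝ φ u v • coordEquiv (0, 1) := by
      rw [← map_smul, ← map_add]; congr 1; ext <;> simp
    simp only [hfd]
    rw [h3, map_add, map_smul, smul_eq_mul]
    rfl
  have hpre : T ⁻¹' subgraph φ = Set.univ ×ˢ Set.Iio 0 := by
    rw [hT, shear_preimage_subgraph, Set.univ_prod]
  rw [← hTm.setIntegral_preimage_emb T.measurableEmbedding, hpre, Measure.volume_eq_prod,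
    ← Measure.prod_restrict, Measure.restrict_univ]
  have hsplit : ∀ p, fderiv ℝ f (T p) e = A p + e 2 * B p := fun p => by
    conv_lhs => rw [he]
    rw [map_add, map_smul, smul_eq_mul]
  simp_rw [hsplit]
  rw [integral_add (hint _) ((hint _).const_mul _), integral_const_mul,
    integral_prod_symm A (hint _), integral_prod B (hint _)]
  simp_rw [hvert, hhor]
  have hswap := integral_integral_swap (f := fun u t => fderiv ℝ φ u v * B (u, t)) hintB
  rw [integral_neg, ← hswap]
  simp_rw [integral_const_mul, hvert]
  have hgi : Integrable fun u => f (graphMap φ u) :=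
    (hf.continuous.comp hφ.continuous_graphMap).integrable_of_hasCompactSupport
      (hfc.comp_isClosedEmbedding hφ.isClosedEmbedding_graphMap)
  rw [← integral_const_mul, neg_add_eq_sub, ← integral_sub (hgi.const_mul _)
    (hgi.bdd_mul (c := C * ‖v‖) hslopem.aestronglyMeasurable (Eventually.of_forall hslope))]
  refine integral_congr_ae (Eventually.of_forall fun u => ?_)
  ring

/-! ### The outer normal and the divergence theorem in a chart -/

theorem IsOuterUnitNormal.outerNormal_eq {Ω : Set E3} {x n : E3} (h : IsOuterUnitNormal Ω x n) :
    outerNormal Ω x = n := by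
  have hex : ∃ n, IsOuterUnitNormal Ω x n := ⟨n, h⟩
  rw [outerNormal, dif_pos hex]
  exact hex.choose_spec.unique h

theorem isOpen_subgraph {φ : E2 → ℝ} (hφ : Continuous φ) : IsOpen (subgraph φ) := by
  rw [← (shear φ hφ).isOpen_preimage, shear_preimage_subgraph]
  exact isOpen_Iio.preimage continuous_snd

theorem frontier_subgraph {φ : E2 → ℝ} (hφ : Continuous φ) :
    frontier (subgraph φ) = Set.range (graphMap φ) := by
  have h : shear φ hφ ⁻¹' frontier (subgraph φ) = Prod.snd ⁻¹' {0} := by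
    rw [(shear φ hφ).preimage_frontier, shear_preimage_subgraph,
      ← isOpenMap_snd.preimage_frontier_eq_frontier_preimage continuous_snd, frontier_Iio]
  rw [← (shear φ hφ).image_preimage (frontier (subgraph φ)), h]
  ext y
  constructor
  · rintro ⟨⟨u, t⟩, ht, rfl⟩
    obtain rfl : t = 0 := ht
    exact ⟨u, by simp [shear_apply, graphMap]⟩
  · rintro ⟨u, rfl⟩
    exact ⟨(u, 0), rfl, by simp [shear_apply, graphMap]⟩

/-- The outer unit normal of the region below the graph of a function with the differential `ℓ`. -/
noncomputable def graphNormal (ℓ : E2 →L[ℝ] ℝ) : E3 :=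
  (areaDensity ℓ)⁻¹ • !₂[-ℓ (EuclideanSpace.single 0 1), -ℓ (EuclideanSpace.single 1 1), 1]

theorem areaDensity_mul_inner_graphNormal (ℓ : E2 →L[ℝ] ℝ) (e : E3) :
    areaDensity ℓ * ⟪e, graphNormal ℓ⟫_ℝ = e 2 - ℓ !₂[e 0, e 1] := by
  have hJ : areaDensity ℓ ≠ 0 := (zero_lt_one.trans_le (one_le_areaDensity ℓ)).ne'
  have hℓ : ℓ !₂[e 0, e 1] = e 0 * ℓ (EuclideanSpace.single 0 1)
      + e 1 * ℓ (EuclideanSpace.single 1 1) := by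
    have : (!₂[e 0, e 1] : E2) = e 0 • EuclideanSpace.single 0 1
        + e 1 • EuclideanSpace.single 1 1 := by
      ext i; fin_cases i <;> simp
    rw [this, map_add, map_smul, map_smul, smul_eq_mul, smul_eq_mul]
  rw [hℓ, graphNormal, inner_smul_right, ← mul_assoc, mul_inv_cancel₀ hJ, one_mul,
    PiLp.inner_apply, Fin.sum_univ_three]
  simp
  ring

theorem norm_graphNormal (ℓ : E2 →L[ℝ] ℝ) : ‖graphNormal ℓ‖ = 1 := by
  have hJ : 0 < areaDensity ℓ := zero_lt_one.trans_le (one_le_areaDensity ℓ)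
  rw [graphNormal, norm_smul, Real.norm_of_nonneg (inv_nonneg.2 hJ.le), EuclideanSpace.norm_eq,
    Fin.sum_univ_three]
  have : √(‖(!₂[-ℓ (EuclideanSpace.single 0 1), -ℓ (EuclideanSpace.single 1 1), 1] : E3) 0‖ ^ 2
      + ‖(!₂[-ℓ (EuclideanSpace.single 0 1), -ℓ (EuclideanSpace.single 1 1), 1] : E3) 1‖ ^ 2
      + ‖(!₂[-ℓ (EuclideanSpace.single 0 1), -ℓ (EuclideanSpace.single 1 1), 1] : E3) 2‖ ^ 2)
      = areaDensity ℓ := by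
    rw [areaDensity]
    congr 1
    simp
    ring
  rw [this, inv_mul_cancel₀ hJ.ne']

/-- If `Ω` is the region below the graph of `φ` near a boundary point where `φ` is differentiable,
the normal of the graph is the outer unit normal there. -/
theorem isOuterUnitNormal_of_graph {Ω U : Set E3} (hU : IsOpen U) {L : E3 ≃ₗᵢ[ℝ] E3} {φ : E2 → ℝ}
    (hΩ : ∀ y ∈ U, y ∈ Ω ↔ L y 2 < φ !₂[L y 0, L y 1]) {u : E2} (hu : DifferentiableAt ℝ φ u)
    (huU : L.symm (graphMap φ u) ∈ U) :
    IsOuterUnitNormal Ω (L.symm (graphMap φ u)) (L.symm (graphNormal (fderiv ℝ φ u))) := by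
  refine ⟨by rw [L.symm.norm_map, norm_graphNormal], fun ε hε => ?_⟩
  set ℓ := fderiv ℝ φ u with hℓ
  have h1 : ∀ᶠ v in 𝓝 u, ‖φ v - φ u - ℓ (v - u)‖ ≤ ε * ‖v - u‖ := by
    have := hu.hasFDerivAt.isLittleO.def hε
    simpa using this
  have hproj : Continuous fun y : E3 => (coordEquiv.symm (L y)).1 := by fun_prop
  have h2 : ∀ᶠ y in 𝓝 (L.symm (graphMap φ u)),
      ‖φ (coordEquiv.symm (L y)).1 - φ u - ℓ ((coordEquiv.symm (L y)).1 - u)‖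
        ≤ ε * ‖(coordEquiv.symm (L y)).1 - u‖ := by
    have h1' : ∀ᶠ v in 𝓝 (coordEquiv.symm (L (L.symm (graphMap φ u)))).1,
        ‖φ v - φ u - ℓ (v - u)‖ ≤ ε * ‖v - u‖ := by
      simpa [graphMap] using h1
    exact hproj.continuousAt.eventually h1'
  filter_upwards [h2, hU.mem_nhds huU] with y hy hyU
  rw [hΩ y hyU]
  set p := coordEquiv.symm (L y) with hp
  have hLy : L y = coordEquiv p := (coordEquiv.apply_symm_apply _).symm
  have hz : L (y - L.symm (graphMap φ u)) = coordEquiv (p.1 - u, p.2 - φ u) := by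
    rw [map_sub, L.apply_symm_apply, hLy, graphMap, ← map_sub]; rfl
  have hn : ‖p.1 - u‖ ≤ ‖y - L.symm (graphMap φ u)‖ := by
    rw [← L.norm_map, hz]; exact norm_fst_le_norm_coordEquiv (p.1 - u, p.2 - φ u)
  have hinner : ⟪y - L.symm (graphMap φ u), L.symm (graphNormal ℓ)⟫_ℝ
      = ⟪coordEquiv (p.1 - u, p.2 - φ u), graphNormal ℓ⟫_ℝ := by
    rw [← hz, ← L.inner_map_map, L.apply_symm_apply]
  have hmul := areaDensity_mul_inner_graphNormal ℓ (coordEquiv (p.1 - u, p.2 - φ u))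
  have hv : (!₂[(coordEquiv (p.1 - u, p.2 - φ u)) 0, (coordEquiv (p.1 - u, p.2 - φ u)) 1] : E2)
      = p.1 - u := by ext i; fin_cases i <;> rfl
  rw [hv, ← hinner, show (coordEquiv (p.1 - u, p.2 - φ u)) 2 = p.2 - φ u from rfl] at hmul
  have hpp : (!₂[L y 0, L y 1] : E2) = p.1 := rfl
  rw [hpp, show L y 2 = p.2 from rfl]
  have hJ := one_le_areaDensity ℓ
  set r := ‖y - L.symm (graphMap φ u)‖ with hr
  have hr0 : 0 ≤ r := norm_nonneg _
  set q := ⟪y - L.symm (graphMap φ u), L.symm (graphNormal ℓ)⟫_ℝ with hq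
  rw [Real.norm_eq_abs, abs_le] at hy
  have hεr : ε * ‖p.1 - u‖ ≤ ε * r := by gcongr
  have hεr0 : 0 ≤ ε * r := by positivity
  constructor
  -- Here `q < 0` (respectively `0 < q` below), so that multiplication by the density, which is at
  -- least `1`, only increases the margin.
  · intro h
    have : areaDensity ℓ * q ≤ q := by nlinarith
    nlinarith
  · intro h
    have : q ≤ areaDensity ℓ * q := by nlinarith
    rw [not_lt]
    nlinarith

/-- The divergence theorem on `Ω` for the vector field `f • e`, with the integrability of the flux
density as part of the claim. -/
def HasFlux (Ω : Set E3) (e : E3) (f : E3 → ℝ) : Prop :=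
  Integrable (fun y => f y * ⟪e, outerNormal Ω y⟫_ℝ) (surfaceMeasure Ω) ∧
    ∫ y in Ω, fderiv ℝ f y e = ∫ y, f y * ⟪e, outerNormal Ω y⟫_ℝ ∂(surfaceMeasure Ω)

theorem frontier_inter_eq_of_graph {Ω U : Set E3} (hU : IsOpen U) {L : E3 ≃ₗᵢ[ℝ] E3} {φ : E2 → ℝ}
    (hφ : Continuous φ) (hΩ : ∀ y ∈ U, y ∈ Ω ↔ L y 2 < φ !₂[L y 0, L y 1]) :
    frontier Ω ∩ U = Set.range (fun u => L.symm (graphMap φ u)) ∩ U := by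
  have h1 : Ω ∩ U = (L ⁻¹' subgraph φ) ∩ U := by
    ext y
    simp only [Set.mem_inter_iff, and_congr_left_iff]
    exact fun hy => hΩ y hy
  rw [← frontier_inter_open_inter hU, h1, frontier_inter_open_inter hU]
  have h2 : frontier (L ⁻¹' subgraph φ) = L ⁻¹' frontier (subgraph φ) :=
    (L.toHomeomorph.preimage_frontier _).symm
  rw [h2, frontier_subgraph hφ]
  congr 1
  ext y
  constructor
  · rintro ⟨u, hu⟩
    exact ⟨u, by simp [hu]⟩
  · rintro ⟨u, rfl⟩
    exact ⟨u, by simp⟩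

/-- The divergence theorem for functions supported in the domain of one chart. -/
theorem hasFlux_of_graph {Ω U : Set E3} (hΩo : IsOpen Ω) (hU : IsOpen U) {L : E3 ≃ₗᵢ[ℝ] E3}
    {φ : E2 → ℝ} {C : ℝ≥0} (hφ : LipschitzWith C φ)
    (hΩ : ∀ y ∈ U, y ∈ Ω ↔ L y 2 < φ !₂[L y 0, L y 1]) {f : E3 → ℝ} (hf : ContDiff ℝ 1 f)
    (hfc : HasCompactSupport f) (hfU : tsupport f ⊆ U) (e : E3) : HasFlux Ω e f := by
  have hf0 : ∀ y ∉ U, f y = 0 := fun y hy => image_eq_zero_of_notMem_tsupport fun h => hy (hfU h)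
  have hdf0 : ∀ y ∉ U, fderiv ℝ f y = 0 := fun y hy =>
    image_eq_zero_of_notMem_tsupport fun h => hy (hfU (tsupport_fderiv_subset ℝ h))
  set Γ : E2 → E3 := fun u => L.symm (graphMap φ u) with hΓ
  have hΓe : MeasurableEmbedding Γ :=
    (L.symm.toHomeomorph.isClosedEmbedding.comp hφ.isClosedEmbedding_graphMap).measurableEmbedding
  set g : E3 → ℝ := fun z => f (L.symm z) with hg
  have hgd : ContDiff ℝ 1 g := hf.comp L.symm.toContinuousLinearEquiv.contDiff
  have hgc : HasCompactSupport g := hfc.comp_homeomorph L.symm.toHomeomorph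
  -- The volume integral, in the coordinates of the chart.
  have hvol : ∫ y in Ω, fderiv ℝ f y e =
      ∫ u, f (Γ u) * (L e 2 - fderiv ℝ φ u !₂[L e 0, L e 1]) := by
    rw [← hφ.integral_subgraph_fderiv hgd hgc (L e)]
    have hpre : MeasurableSet (L ⁻¹' subgraph φ) :=
      ((isOpen_subgraph hφ.continuous).preimage L.continuous).measurableSet
    rw [← L.measurePreserving.setIntegral_preimage_emb L.toHomeomorph.measurableEmbedding
      (fun z => fderiv ℝ g z (L e)) (subgraph φ),
      ← integral_indicator hΩo.measurableSet, ← integral_indicator hpre]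
    refine integral_congr_ae (Eventually.of_forall fun y => ?_)
    have hfd : fderiv ℝ g (L y) (L e) = fderiv ℝ f y e := by
      have h1 : HasFDerivAt g ((fderiv ℝ f y) ∘L
          (L.symm.toContinuousLinearEquiv : E3 →L[ℝ] E3)) (L y) := by
        have h2 := (hf.differentiable one_ne_zero (L.symm (L y))).hasFDerivAt
        rw [L.symm_apply_apply] at h2
        exact HasFDerivAt.comp (L y) (by rw [L.symm_apply_apply]; exact h2)
          L.symm.toContinuousLinearEquiv.hasFDerivAt
      rw [h1.fderiv]
      simp
    classical
    have hiff : y ∈ U → (y ∈ Ω ↔ y ∈ L ⁻¹' subgraph φ) := fun hy => hΩ y hy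
    have h0 : y ∉ U → fderiv ℝ f y e = 0 := fun hy => by rw [hdf0 y hy]; rfl
    change Ω.indicator (fun y => fderiv ℝ f y e) y =
      (L ⁻¹' subgraph φ).indicator (fun y => fderiv ℝ g (L y) (L e)) y
    rw [Set.indicator_apply, Set.indicator_apply, hfd]
    by_cases hy : y ∈ U
    · simp only [hiff hy]
    · simp only [h0 hy, ite_self]
  -- The surface integral, in the coordinates of the chart.
  set G : E3 → ℝ := fun y => f y * ⟪e, outerNormal Ω y⟫_ℝ with hG
  have hcomap : (μHE[2] : Measure E3).comap Γ =
      volume.withDensity (fun u => ENNReal.ofReal (areaDensity (fderiv ℝ φ u))) := by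
    rw [← hφ.comap_graphMap_euclideanHausdorffMeasure]
    ext s hs
    rw [hΓe.comap_apply, hφ.measurableEmbedding_graphMap.comap_apply,
      ← L.symm.isometry.euclideanHausdorffMeasure_image (graphMap φ '' s), Set.image_image]
  have hJm : Measurable fun u => areaDensity (fderiv ℝ φ u) :=
    continuous_areaDensity.measurable.comp (measurable_fderiv ℝ φ)
  have hae : ∀ᵐ u, areaDensity (fderiv ℝ φ u) * G (Γ u) =
      f (Γ u) * (L e 2 - fderiv ℝ φ u !₂[L e 0, L e 1]) := by
    filter_upwards [hφ.ae_differentiableAt] with u hu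
    by_cases huU : Γ u ∈ U
    · rw [hG]
      simp only
      rw [(isOuterUnitNormal_of_graph hU hΩ hu huU).outerNormal_eq,
        ← areaDensity_mul_inner_graphNormal, ← L.inner_map_map, L.apply_symm_apply]
      ring
    · simp [hG, hf0 _ huU]
  have hrestr : ((μHE[2] : Measure E3).restrict (frontier Ω)).restrict U
      = ((μHE[2] : Measure E3).restrict (Set.range Γ)).restrict U := by
    rw [Measure.restrict_restrict hU.measurableSet, Measure.restrict_restrict hU.measurableSet,
      Set.inter_comm, frontier_inter_eq_of_graph hU hφ.continuous hΩ, Set.inter_comm]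
  have hGsupp : ∀ y ∉ U, G y = 0 := fun y hy => by simp [hG, hf0 y hy]
  have hsm : surfaceMeasure Ω = (μHE[2] : Measure E3).restrict (frontier Ω) := rfl
  have hslope : ∀ u, ‖L e 2 - fderiv ℝ φ u !₂[L e 0, L e 1]‖
      ≤ ‖L e 2‖ + C * ‖(!₂[L e 0, L e 1] : E2)‖ := fun u =>
    (norm_sub_le _ _).trans (by
      gcongr
      exact (fderiv ℝ φ u).le_of_opNorm_le (norm_fderiv_le_of_lipschitz ℝ hφ) _)
  have hint0 : Integrable fun u => f (Γ u) * (L e 2 - fderiv ℝ φ u !₂[L e 0, L e 1]) := by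
    refine Integrable.mul_bdd (c := ‖L e 2‖ + C * ‖(!₂[L e 0, L e 1] : E2)‖) ?_ ?_
      (Eventually.of_forall hslope)
    · exact (hgd.continuous.comp hφ.continuous_graphMap).integrable_of_hasCompactSupport
        (hgc.comp_isClosedEmbedding hφ.isClosedEmbedding_graphMap)
    · exact ((measurable_fderiv_apply_const ℝ φ _).const_sub _).aestronglyMeasurable
  have hint1 : Integrable (fun u => G (Γ u)) ((μHE[2] : Measure E3).comap Γ) := by
    rw [hcomap, integrable_withDensity_iff_integrable_smul₀' hJm.ennreal_ofReal.aemeasurable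
      (Eventually.of_forall fun u => ENNReal.ofReal_lt_top)]
    refine hint0.congr ?_
    filter_upwards [hae] with u hu
    rw [← hu, ENNReal.toReal_ofReal (zero_le_one.trans (one_le_areaDensity _)), smul_eq_mul]
  have hmap : ((μHE[2] : Measure E3).comap Γ).map Γ
      = (μHE[2] : Measure E3).restrict (Set.range Γ) := hΓe.map_comap _
  have hint2 : IntegrableOn G U (surfaceMeasure Ω) := by
    rw [IntegrableOn, hsm, hrestr, ← hmap]
    exact Integrable.restrict (hΓe.integrable_map_iff.2 (show Integrable (G ∘ Γ) _ from hint1))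
  refine ⟨(integrableOn_iff_integrable_of_support_subset fun y hy => ?_).1 hint2, ?_⟩
  · by_contra h; exact hy (hGsupp y h)
  · rw [hvol, ← setIntegral_eq_integral_of_forall_compl_eq_zero (s := U) (fun y hy => hGsupp y hy),
      hsm, hrestr, setIntegral_eq_integral_of_forall_compl_eq_zero (s := U)
      (fun y hy => hGsupp y hy), ← hmap, hΓe.integral_map, hcomap,
      integral_withDensity_eq_integral_toReal_smul₀ hJm.ennreal_ofReal.aemeasurable
      (Eventually.of_forall fun u => ENNReal.ofReal_lt_top)]
    refine integral_congr_ae ?_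
    filter_upwards [hae] with u hu
    rw [← hu, ENNReal.toReal_ofReal (zero_le_one.trans (one_le_areaDensity _)), smul_eq_mul]

/-! ### The divergence theorem on a bounded Lipschitz domain -/

/-- The integral of a directional derivative of a compactly supported `C¹` function vanishes. -/
theorem integral_fderiv_apply_eq_zero {F : Type*} [NormedAddCommGroup F] [NormedSpace ℝ F]
    {f : E3 → F} (hf : ContDiff ℝ 1 f) (hfc : HasCompactSupport f) (e : E3) :
    ∫ y, fderiv ℝ f y e = 0 := by
  have hi : Integrable fun y => fderiv ℝ f y e :=
    ((hf.continuous_fderiv one_ne_zero).clm_apply continuous_const).integrable_of_hasCompactSupport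
      (hfc.fderiv_apply (𝕜 := ℝ) e)
  have h := integral_smul_fderiv_eq_neg_fderiv_smul_of_integrable (μ := (volume : Measure E3))
    (f := fun _ : E3 => (1 : ℝ)) (g := f) (v := e) (by simp) (by simpa using hi)
    (by simpa using hf.continuous.integrable_of_hasCompactSupport hfc)
    (fun x _ => differentiableAt_const _) (fun x _ => hf.differentiable one_ne_zero x)
  simpa using h

/-- Off the boundary the extension of `f` from `Ω` by zero is still `C¹`, and both sides vanish. -/
theorem hasFlux_of_disjoint_frontier {Ω : Set E3} (hΩo : IsOpen Ω) {f : E3 → ℝ}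
    (hf : ContDiff ℝ 1 f) (hfc : HasCompactSupport f) (hfΩ : tsupport f ⊆ (frontier Ω)ᶜ) (e : E3) :
    HasFlux Ω e f := by
  have hf0 : ∀ y ∈ frontier Ω, f y = 0 := fun y hy =>
    image_eq_zero_of_notMem_tsupport fun h => hfΩ h hy
  have hfr : MeasurableSet (frontier Ω) := isClosed_frontier.measurableSet
  have hG : (fun y => f y * ⟪e, outerNormal Ω y⟫_ℝ) =ᵐ[surfaceMeasure Ω] 0 := by
    filter_upwards [ae_restrict_mem hfr] with y hy
    simp [hf0 y hy]
  refine ⟨(integrable_zero _ _ _).congr hG.symm, ?_⟩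
  rw [integral_congr_ae hG]
  have hloc : ∀ x, (Ω.indicator f =ᶠ[𝓝 x] f ∧ x ∈ Ω) ∨ (Ω.indicator f =ᶠ[𝓝 x] 0 ∧
      (x ∉ Ω ∨ fderiv ℝ f x = 0)) := by
    intro x
    by_cases hx : x ∈ Ω
    · left
      exact ⟨Filter.eventuallyEq_of_mem (hΩo.mem_nhds hx) fun y hy => Set.indicator_of_mem hy f, hx⟩
    right
    refine ⟨?_, Or.inl hx⟩
    by_cases hxc : x ∈ closure Ω
    · have hxf : x ∈ frontier Ω := ⟨hxc, by rwa [hΩo.interior_eq]⟩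
      have : f =ᶠ[𝓝 x] 0 := notMem_tsupport_iff_eventuallyEq.1 fun h => hfΩ h hxf
      filter_upwards [this] with y hy
      simp [hy]
    · exact Filter.eventuallyEq_of_mem (isClosed_closure.isOpen_compl.mem_nhds hxc) fun y hy =>
        Set.indicator_of_notMem (fun h => hy (subset_closure h)) f
  have hd : ContDiff ℝ 1 (Ω.indicator f) := by
    rw [contDiff_iff_contDiffAt]
    intro x
    rcases hloc x with h | h
    · exact hf.contDiffAt.congr_of_eventuallyEq h.1
    · exact contDiffAt_const.congr_of_eventuallyEq h.1
  have hc : HasCompactSupport (Ω.indicator f) :=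
    hfc.mono fun y hy hy0 => hy (by simp [hy0])
  have h := integral_fderiv_apply_eq_zero hd hc e
  rw [← integral_indicator hΩo.measurableSet]
  simp only [Pi.zero_apply, integral_zero]
  rw [← h]
  refine integral_congr_ae (Eventually.of_forall fun x => ?_)
  change Ω.indicator (fun y => fderiv ℝ f y e) x = fderiv ℝ (Ω.indicator f) x e
  rcases hloc x with ⟨h, hx⟩ | ⟨h, hx⟩
  · rw [Set.indicator_of_mem hx, h.fderiv_eq]
  · rw [h.fderiv_eq]
    rcases hx with hx | hx
    · rw [Set.indicator_of_notMem hx]; simp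
    · simp [hx]

theorem HasFlux.sum {Ω : Set E3} {e : E3} {ι : Type*} {s : Finset ι} {f : ι → E3 → ℝ}
    (hf : ∀ i ∈ s, ContDiff ℝ 1 (f i)) (hfc : ∀ i ∈ s, HasCompactSupport (f i))
    (h : ∀ i ∈ s, HasFlux Ω e (f i)) : HasFlux Ω e (fun y => ∑ i ∈ s, f i y) := by
  have hfd : ∀ y, fderiv ℝ (fun y => ∑ i ∈ s, f i y) y e = ∑ i ∈ s, fderiv ℝ (f i) y e := by
    intro y
    rw [fderiv_fun_sum fun i hi => (hf i hi).differentiable one_ne_zero y]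
    simp
  refine ⟨?_, ?_⟩
  · simp_rw [Finset.sum_mul]
    exact integrable_finsetSum _ fun i hi => (h i hi).1
  · simp_rw [hfd, Finset.sum_mul]
    rw [integral_finsetSum _ fun i hi => (h i hi).1, integral_finsetSum]
    · exact Finset.sum_congr rfl fun i hi => (h i hi).2
    · intro i hi
      have hc : Continuous fun y => fderiv ℝ (f i) y e :=
        ((hf i hi).continuous_fderiv one_ne_zero).clm_apply continuous_const
      exact (hc.integrable_of_hasCompactSupport
        ((hfc i hi).fderiv_apply (𝕜 := ℝ) e)).integrableOn

/-- The divergence theorem on a bounded Lipschitz domain, for a vector field of constant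
direction. -/
theorem IsBoundedLipschitzDomain.hasFlux {Ω : Set E3} (hΩ : IsBoundedLipschitzDomain Ω)
    {f : E3 → ℝ} (hf : ContDiff ℝ 1 f) (hfc : HasCompactSupport f) (e : E3) :
    HasFlux Ω e f := by
  have hloc : ∀ x, ∃ U : Set E3, IsOpen U ∧ x ∈ U ∧ ∀ g : E3 → ℝ, ContDiff ℝ 1 g →
      HasCompactSupport g → tsupport g ⊆ U → HasFlux Ω e g := by
    intro x
    by_cases hx : x ∈ frontier Ω
    · obtain ⟨U, hU, hxU, L, φ, C, hφ, h⟩ := hΩ.locally_graph x hx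
      exact ⟨U, hU, hxU, fun g hg hgc hgU => hasFlux_of_graph hΩ.isOpen hU hφ h hg hgc hgU e⟩
    · exact ⟨(frontier Ω)ᶜ, isClosed_frontier.isOpen_compl, hx, fun g hg hgc hgU =>
        hasFlux_of_disjoint_frontier hΩ.isOpen hg hgc hgU e⟩
  choose U hUo hxU hU using hloc
  obtain ⟨ρ, hρ⟩ := SmoothPartitionOfUnity.exists_isSubordinate (modelWithCornersSelf ℝ E3)
    isClosed_univ U hUo (fun x _ => Set.mem_iUnion.2 ⟨x, hxU x⟩)
  have hfin := ρ.locallyFinite.finite_nonempty_inter_compact hfc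
  set s := hfin.toFinset with hs
  have hfs : f = fun y => ∑ i ∈ s, ρ i y * f y := by
    funext y
    by_cases hy : y ∈ tsupport f
    · have h1 := ρ.sum_eq_one (Set.mem_univ y)
      rw [finsum_eq_sum_of_support_subset (s := s)] at h1
      · rw [← Finset.sum_mul, h1, one_mul]
      · intro i hi
        rw [hs, Set.Finite.coe_toFinset]
        exact ⟨y, hi, hy⟩
    · simp [image_eq_zero_of_notMem_tsupport hy]
  have hd : ∀ i, ContDiff ℝ 1 fun y => ρ i y * f y := fun i =>
    ((ρ i).contMDiff.contDiff.of_le (by simp)).mul hf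
  have hc : ∀ i, HasCompactSupport fun y => ρ i y * f y := fun i => hfc.mul_left
  rw [hfs]
  refine HasFlux.sum (fun i _ => hd i) (fun i _ => hc i) fun i _ => hU i _ (hd i) (hc i) ?_
  exact (tsupport_mul_subset_left).trans (hρ i)

/-- The divergence theorem for complex-valued functions. -/
theorem IsBoundedLipschitzDomain.integral_fderiv {Ω : Set E3} (hΩ : IsBoundedLipschitzDomain Ω)
    {f : E3 → ℂ} (hf : ContDiff ℝ 1 f) (hfc : HasCompactSupport f) (e : E3) :
    Integrable (fun y => (⟪e, outerNormal Ω y⟫_ℝ : ℂ) * f y) (surfaceMeasure Ω) ∧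
      ∫ y in Ω, fderiv ℝ f y e =
        ∫ y, (⟪e, outerNormal Ω y⟫_ℝ : ℂ) * f y ∂(surfaceMeasure Ω) := by
  have hre := hΩ.hasFlux (Complex.reCLM.contDiff.comp hf) (hfc.comp_left (g := Complex.reCLM)
    (map_zero _)) e
  have him := hΩ.hasFlux (Complex.imCLM.contDiff.comp hf) (hfc.comp_left (g := Complex.imCLM)
    (map_zero _)) e
  have hfd := hf.differentiable one_ne_zero
  have dre : ∀ y, fderiv ℝ (Complex.reCLM ∘ f) y e = Complex.reCLM (fderiv ℝ f y e) := fun y => by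
    rw [(Complex.reCLM.hasFDerivAt.comp y (hfd y).hasFDerivAt).fderiv]; rfl
  have dim : ∀ y, fderiv ℝ (Complex.imCLM ∘ f) y e = Complex.imCLM (fderiv ℝ f y e) := fun y => by
    rw [(Complex.imCLM.hasFDerivAt.comp y (hfd y).hasFDerivAt).fderiv]; rfl
  have hint : Integrable (fun y => (⟪e, outerNormal Ω y⟫_ℝ : ℂ) * f y) (surfaceMeasure Ω) := by
    have h := hre.1.ofReal (𝕜 := ℂ) |>.add ((him.1.ofReal (𝕜 := ℂ)).mul_const Complex.I)
    refine h.congr (Eventually.of_forall fun y => ?_)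
    apply Complex.ext <;> simp [mul_comm]
  refine ⟨hint, ?_⟩
  have hintd : Integrable (fun y => fderiv ℝ f y e) (volume.restrict Ω) :=
    ((((hf.continuous_fderiv one_ne_zero).clm_apply
      continuous_const).integrable_of_hasCompactSupport
        (hfc.fderiv_apply (𝕜 := ℝ) e))).integrableOn
  apply Complex.ext
  · have h := hre.2
    simp_rw [dre] at h
    rw [Complex.reCLM.integral_comp_comm hintd] at h
    change Complex.reCLM _ = Complex.reCLM _
    rw [h, ← Complex.reCLM.integral_comp_comm hint]
    refine integral_congr_ae (Eventually.of_forall fun y => ?_)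
    simp [mul_comm]
  · have h := him.2
    simp_rw [dim] at h
    rw [Complex.imCLM.integral_comp_comm hintd] at h
    change Complex.imCLM _ = Complex.imCLM _
    rw [h, ← Complex.imCLM.integral_comp_comm hint]
    refine integral_congr_ae (Eventually.of_forall fun y => ?_)
    simp [mul_comm]

/-! ### Green's second identity -/

theorem exists_smooth_cutoff {K V : Set E3} (hK : IsCompact K) (hV : IsOpen V) (hKV : K ⊆ V) :
    ∃ χ : E3 → ℝ, ContDiff ℝ ∞ χ ∧ HasCompactSupport χ ∧ tsupport χ ⊆ V ∧
      (∀ x ∈ K, χ =ᶠ[𝓝 x] 1) ∧ ∀ x, χ x ∈ Set.Icc 0 1 := by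
  obtain ⟨T, hT, hKT, hTV⟩ := exists_compact_between hK hV hKV
  obtain ⟨χ, h1, h0, h01⟩ := exists_contMDiffMap_one_nhds_of_subset_interior
    (modelWithCornersSelf ℝ E3) (n := ⊤) hK.isClosed hKT
  have hs : tsupport χ ⊆ T := closure_minimal (fun x hx => by
    by_contra h; exact hx (h0 x h)) hT.isClosed
  refine ⟨χ, χ.contMDiff.contDiff, hT.of_isClosed_subset (isClosed_tsupport _) hs, hs.trans hTV,
    fun x hx => ?_, h01⟩
  exact Filter.Eventually.filter_mono (nhds_le_nhdsSet hx) h1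

/-- The `i`-th standard unit vector. -/
noncomputable abbrev stdVec (i : Fin 3) : E3 := EuclideanSpace.single i 1

theorem laplacian_eq_sum_fderiv (f : E3 → ℂ) (x : E3) :
    Δ f x = ∑ i, fderiv ℝ (fderiv ℝ f) x (stdVec i) (stdVec i) := by
  rw [InnerProductSpace.laplacian_eq_iteratedFDeriv_orthonormalBasis f
    (EuclideanSpace.basisFun (Fin 3) ℝ)]
  simp [iteratedFDeriv_two_apply]

/-- The `i`-th component of the vector field `u ∇v - v ∇u`. -/
noncomputable def greenField (u v : E3 → ℂ) (i : Fin 3) (y : E3) : ℂ :=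
  u y * fderiv ℝ v y (stdVec i) - v y * fderiv ℝ u y (stdVec i)

theorem ContDiff.greenField {u v : E3 → ℂ} (hu : ContDiff ℝ 2 u) (hv : ContDiff ℝ 2 v)
    (i : Fin 3) : ContDiff ℝ 1 (greenField u v i) := by
  have h1 : ContDiff ℝ 1 (fderiv ℝ u) := hu.fderiv_right (by norm_num)
  have h2 : ContDiff ℝ 1 (fderiv ℝ v) := hv.fderiv_right (by norm_num)
  have hu1 : ContDiff ℝ 1 u := hu.of_le (by norm_num)
  have hv1 : ContDiff ℝ 1 v := hv.of_le (by norm_num)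
  exact (hu1.mul (h2.clm_apply contDiff_const)).sub (hv1.mul (h1.clm_apply contDiff_const))

theorem HasCompactSupport.greenField_left {u v : E3 → ℂ} (hu : HasCompactSupport u) (i : Fin 3) :
    HasCompactSupport (_root_.greenField u v i) := by
  have h : HasCompactSupport fun y => u y * fderiv ℝ v y (stdVec i) := hu.mul_right
  have h' : HasCompactSupport fun y => v y * fderiv ℝ u y (stdVec i) :=
    (hu.fderiv_apply (𝕜 := ℝ) _).mul_left
  exact h.sub h'

theorem sum_fderiv_greenField {u v : E3 → ℂ} (hu : ContDiff ℝ 2 u) (hv : ContDiff ℝ 2 v) (x : E3) :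
    ∑ i, fderiv ℝ (greenField u v i) x (stdVec i) = u x * Δ v x - v x * Δ u x := by
  have h1 : ContDiff ℝ 1 (fderiv ℝ u) := hu.fderiv_right (by norm_num)
  have h2 : ContDiff ℝ 1 (fderiv ℝ v) := hv.fderiv_right (by norm_num)
  have d1 := (h1.differentiable one_ne_zero x).hasFDerivAt
  have d2 := (h2.differentiable one_ne_zero x).hasFDerivAt
  have du := (hu.differentiable two_ne_zero x).hasFDerivAt
  have dv := (hv.differentiable two_ne_zero x).hasFDerivAt
  rw [laplacian_eq_sum_fderiv, laplacian_eq_sum_fderiv, Finset.mul_sum, Finset.mul_sum,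
    ← Finset.sum_sub_distrib]
  refine Finset.sum_congr rfl fun i _ => ?_
  have h := (du.mul (d2.clm_apply (hasFDerivAt_const (stdVec i) x))).sub
    (dv.mul (d1.clm_apply (hasFDerivAt_const (stdVec i) x)))
  have h' : fderiv ℝ (greenField u v i) x = _ := h.fderiv
  rw [h']
  simp
  ring

/-- Green's second identity on a bounded Lipschitz domain. -/
theorem IsBoundedLipschitzDomain.green {Ω : Set E3} (hΩ : IsBoundedLipschitzDomain Ω)
    {u v : E3 → ℂ} (hu : ContDiff ℝ 2 u) (hv : ContDiff ℝ 2 v) (huc : HasCompactSupport u) :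
    Integrable (fun y => u y * normalDeriv Ω v y - v y * normalDeriv Ω u y) (surfaceMeasure Ω) ∧
      ∫ y in Ω, (u y * Δ v y - v y * Δ u y) =
        ∫ y, (u y * normalDeriv Ω v y - v y * normalDeriv Ω u y) ∂(surfaceMeasure Ω) := by
  have h := fun i => hΩ.integral_fderiv (hu.greenField hv i) (huc.greenField_left i) (stdVec i)
  have hν : ∀ y, u y * normalDeriv Ω v y - v y * normalDeriv Ω u y =
      ∑ i, (⟪stdVec i, outerNormal Ω y⟫_ℝ : ℂ) * greenField u v i y := by
    intro y
    have hn : outerNormal Ω y = ∑ i, ⟪stdVec i, outerNormal Ω y⟫_ℝ • stdVec i := by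
      have := (EuclideanSpace.basisFun (Fin 3) ℝ).sum_repr' (outerNormal Ω y)
      simpa using this.symm
    have hl : ∀ ℓ : E3 →L[ℝ] ℂ, ℓ (outerNormal Ω y) =
        ∑ i, (⟪stdVec i, outerNormal Ω y⟫_ℝ : ℂ) * ℓ (stdVec i) := fun ℓ => by
      conv_lhs => rw [hn]
      simp only [map_sum, map_smul, Complex.real_smul]
    rw [normalDeriv, normalDeriv, hl, hl, Finset.mul_sum, Finset.mul_sum,
      ← Finset.sum_sub_distrib]
    refine Finset.sum_congr rfl fun i _ => ?_
    rw [greenField]; ring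
  simp_rw [hν, ← sum_fderiv_greenField hu hv]
  refine ⟨integrable_finsetSum _ fun i _ => (h i).1, ?_⟩
  rw [integral_finsetSum _ fun i _ => (h i).1, integral_finsetSum]
  · exact Finset.sum_congr rfl fun i _ => (h i).2
  · intro i _
    exact ((((hu.greenField hv i).continuous_fderiv one_ne_zero).clm_apply
      continuous_const).integrable_of_hasCompactSupport
        ((huc.greenField_left i).fderiv_apply (𝕜 := ℝ) _)).integrableOn

/-- Green's second identity on the whole space, with a cutoff function `η`. -/
theorem integral_cutoff_mul_green {u v : E3 → ℂ} (hu : ContDiff ℝ 2 u) (hv : ContDiff ℝ 2 v)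
    {η : E3 → ℝ} (hη : ContDiff ℝ 1 η) (hηc : HasCompactSupport η) :
    ∫ y, (η y : ℂ) * (u y * Δ v y - v y * Δ u y) =
      -∫ y, ∑ i, (fderiv ℝ η y (stdVec i) : ℂ) * greenField u v i y := by
  have hηC : ContDiff ℝ 1 fun y => (η y : ℂ) := Complex.ofRealCLM.contDiff.comp hη
  have hηcC : HasCompactSupport fun y => (η y : ℂ) := hηc.comp_left (g := fun t : ℝ => (t : ℂ)) rfl
  have hd := fun i => hηC.mul (hu.greenField hv i)
  have hc : ∀ i, HasCompactSupport fun y => (η y : ℂ) * greenField u v i y :=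
    fun i => hηcC.mul_right
  have h0 := fun i => integral_fderiv_apply_eq_zero (hd i) (hc i) (stdVec i)
  have hfd : ∀ i y, fderiv ℝ (fun y => (η y : ℂ) * greenField u v i y) y (stdVec i) =
      (η y : ℂ) * fderiv ℝ (greenField u v i) y (stdVec i) +
        (fderiv ℝ η y (stdVec i) : ℂ) * greenField u v i y := by
    intro i y
    have h1 : HasFDerivAt (fun y => (η y : ℂ)) (Complex.ofRealCLM ∘L fderiv ℝ η y) y :=
      Complex.ofRealCLM.hasFDerivAt.comp y (hη.differentiable one_ne_zero y).hasFDerivAt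
    have h2 := ((hu.greenField hv i).differentiable one_ne_zero y).hasFDerivAt
    have h3 : fderiv ℝ (fun y => (η y : ℂ) * greenField u v i y) y = _ := (h1.mul h2).fderiv
    rw [h3]
    simp [mul_comm]
  simp_rw [hfd] at h0
  have hi1 : ∀ i, Integrable fun y => (η y : ℂ) * fderiv ℝ (greenField u v i) y (stdVec i) :=
    fun i => (hηC.continuous.mul (((hu.greenField hv i).continuous_fderiv one_ne_zero).clm_apply
      continuous_const)).integrable_of_hasCompactSupport hηcC.mul_right
  have hi2 : ∀ i, Integrable fun y => (fderiv ℝ η y (stdVec i) : ℂ) * greenField u v i y := by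
    intro i
    refine Continuous.integrable_of_hasCompactSupport ?_ ?_
    · exact (Complex.continuous_ofReal.comp ((hη.continuous_fderiv one_ne_zero).clm_apply
        continuous_const)).mul (hu.greenField hv i).continuous
    · exact ((hηc.fderiv_apply (𝕜 := ℝ) _).comp_left (g := fun t : ℝ => (t : ℂ)) rfl).mul_right
  simp_rw [← sum_fderiv_greenField hu hv, Finset.mul_sum]
  rw [integral_finsetSum _ fun i _ => hi1 i, integral_finsetSum _ fun i _ => hi2 i,
    eq_neg_iff_add_eq_zero, ← Finset.sum_add_distrib]
  refine Finset.sum_eq_zero fun i _ => ?_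
  rw [← integral_add (hi1 i) (hi2 i), h0 i]

theorem integral_green_eq_zero {u v : E3 → ℂ} (hu : ContDiff ℝ 2 u) (hv : ContDiff ℝ 2 v)
    (huc : HasCompactSupport u) : ∫ y, (u y * Δ v y - v y * Δ u y) = 0 := by
  simp_rw [← sum_fderiv_greenField hu hv]
  rw [integral_finsetSum]
  · exact Finset.sum_eq_zero fun i _ =>
      integral_fderiv_apply_eq_zero (hu.greenField hv i) (huc.greenField_left i) _
  · intro i _
    exact (((hu.greenField hv i).continuous_fderiv one_ne_zero).clm_apply
      continuous_const).integrable_of_hasCompactSupport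
        ((huc.greenField_left i).fderiv_apply (𝕜 := ℝ) _)

/-! ### Radial functions and the fundamental solution -/

theorem ContDiffAt.differentiableAt_fderiv {f : E3 → ℂ} {x : E3} (hf : ContDiffAt ℝ 2 f x) :
    DifferentiableAt ℝ (fderiv ℝ f) x :=
  (hf.fderiv_right (m := 1) (by norm_num)).differentiableAt one_ne_zero

theorem ContDiffAt.laplacian_eq_sum {f : E3 → ℂ} {x : E3} (hf : ContDiffAt ℝ 2 f x) :
    Δ f x = ∑ i, fderiv ℝ (fun z => fderiv ℝ f z (stdVec i)) x (stdVec i) := by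
  rw [laplacian_eq_sum_fderiv]
  refine Finset.sum_congr rfl fun i _ => ?_
  have h := hf.differentiableAt_fderiv.hasFDerivAt.clm_apply (hasFDerivAt_const (stdVec i) x)
  rw [h.fderiv]
  simp

/-- The Laplacian of a product. -/
theorem ContDiffAt.laplacian_mul {f g : E3 → ℂ} {x : E3} (hf : ContDiffAt ℝ 2 f x)
    (hg : ContDiffAt ℝ 2 g x) :
    Δ (fun y => f y * g y) x = f x * Δ g x
      + 2 * ∑ i, fderiv ℝ f x (stdVec i) * fderiv ℝ g x (stdVec i) + g x * Δ f x := by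
  have hfe : ∀ᶠ y in 𝓝 x, DifferentiableAt ℝ f y :=
    (hf.eventually (by simp)).mono fun y hy => hy.differentiableAt two_ne_zero
  have hge : ∀ᶠ y in 𝓝 x, DifferentiableAt ℝ g y :=
    (hg.eventually (by simp)).mono fun y hy => hy.differentiableAt two_ne_zero
  have d1 := hf.differentiableAt_fderiv.hasFDerivAt
  have d2 := hg.differentiableAt_fderiv.hasFDerivAt
  have df := (hf.differentiableAt two_ne_zero).hasFDerivAt
  have dg := (hg.differentiableAt two_ne_zero).hasFDerivAt
  rw [(hf.mul hg).laplacian_eq_sum, laplacian_eq_sum_fderiv, laplacian_eq_sum_fderiv,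
    Finset.mul_sum, Finset.mul_sum, Finset.mul_sum, ← Finset.sum_add_distrib,
    ← Finset.sum_add_distrib]
  refine Finset.sum_congr rfl fun i _ => ?_
  have he : (fun z => fderiv ℝ (fun y => f y * g y) z (stdVec i)) =ᶠ[𝓝 x]
      fun z => f z * fderiv ℝ g z (stdVec i) + g z * fderiv ℝ f z (stdVec i) := by
    filter_upwards [hfe, hge] with z hz hz'
    have h : fderiv ℝ (fun y => f y * g y) z = _ := (hz.hasFDerivAt.mul hz'.hasFDerivAt).fderiv
    rw [h]
    simp
  have h := (df.mul (d2.clm_apply (hasFDerivAt_const (stdVec i) x))).add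
    (dg.mul (d1.clm_apply (hasFDerivAt_const (stdVec i) x)))
  have h' : fderiv ℝ (fun z => f z * fderiv ℝ g z (stdVec i) + g z * fderiv ℝ f z (stdVec i)) x
    = _ := h.fderiv
  change fderiv ℝ (fun z => fderiv ℝ (fun y => f y * g y) z (stdVec i)) x _ = _
  rw [he.fderiv_eq, h']
  simp
  ring

theorem inner_stdVec (z : E3) (i : Fin 3) : ⟪z, stdVec i⟫_ℝ = z i := by
  simp [EuclideanSpace.inner_single_right]

theorem hasFDerivAt_radial {h : ℝ → ℂ} {h' : ℂ} {x y : E3}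
    (hh : HasDerivAt h h' (‖y - x‖ ^ 2)) :
    HasFDerivAt (fun z : E3 => h (‖z - x‖ ^ 2))
      (((2 : ℝ) • innerSL ℝ (y - x)).smulRight h') y := by
  have h1 : HasFDerivAt (fun z : E3 => ‖z - x‖ ^ 2) ((2 : ℝ) • innerSL ℝ (y - x)) y := by
    have := ((hasFDerivAt_id y).sub_const x).norm_sq
    refine this.congr_fderiv ?_
    ext v; simp
  have h2 := hh.hasFDerivAt.comp y h1
  refine h2.congr_fderiv ?_
  ext v; simp; ring

/-- The Laplacian of a radial function in three dimensions, in terms of `q = |y - x|²`. -/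
theorem laplacian_radial {h h₁ : ℝ → ℂ} {h₂ : ℂ} {x y : E3}
    (hf : ContDiffAt ℝ 2 (fun z : E3 => h (‖z - x‖ ^ 2)) y)
    (hh : ∀ᶠ q in 𝓝 (‖y - x‖ ^ 2), HasDerivAt h (h₁ q) q)
    (hh₁ : HasDerivAt h₁ h₂ (‖y - x‖ ^ 2)) :
    Δ (fun z : E3 => h (‖z - x‖ ^ 2)) y = 4 * ‖y - x‖ ^ 2 * h₂ + 6 * h₁ (‖y - x‖ ^ 2) := by
  rw [hf.laplacian_eq_sum]
  have hc : Continuous fun z : E3 => ‖z - x‖ ^ 2 := by fun_prop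
  have hterm : ∀ i, fderiv ℝ (fun z => fderiv ℝ (fun z : E3 => h (‖z - x‖ ^ 2)) z (stdVec i)) y
      (stdVec i) = 4 * ((y - x) i : ℂ) ^ 2 * h₂ + 2 * h₁ (‖y - x‖ ^ 2) := by
    intro i
    have he : (fun z => fderiv ℝ (fun z : E3 => h (‖z - x‖ ^ 2)) z (stdVec i)) =ᶠ[𝓝 y]
        fun z => (((2 * (z i - x i) : ℝ)) : ℂ) * h₁ (‖z - x‖ ^ 2) := by
      filter_upwards [hc.continuousAt.eventually hh] with z hz
      rw [(hasFDerivAt_radial hz).fderiv]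
      simp [inner_stdVec]
    have d0 : HasFDerivAt (fun z : E3 => 2 * (z i - x i))
        ((2 : ℝ) • (EuclideanSpace.proj i : E3 →L[ℝ] ℝ)) y := by
      have := (((EuclideanSpace.proj i : E3 →L[ℝ] ℝ).hasFDerivAt (x := y)).sub_const
        (x i)).const_mul (2 : ℝ)
      exact this
    have d1 : HasFDerivAt (fun z : E3 => (((2 * (z i - x i) : ℝ)) : ℂ))
        (Complex.ofRealCLM ∘L ((2 : ℝ) • (EuclideanSpace.proj i : E3 →L[ℝ] ℝ))) y :=
      Complex.ofRealCLM.hasFDerivAt.comp y d0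
    have d2 := d1.mul (hasFDerivAt_radial hh₁)
    have d3 : fderiv ℝ (fun z : E3 => (((2 * (z i - x i) : ℝ)) : ℂ) * h₁ (‖z - x‖ ^ 2)) y = _ :=
      d2.fderiv
    rw [he.fderiv_eq, d3]
    simp [inner_stdVec]
    ring
  simp_rw [hterm]
  have hq : (‖y - x‖ : ℂ) ^ 2 = ∑ i, ((y - x) i : ℂ) ^ 2 := by
    rw [← Complex.ofReal_pow, EuclideanSpace.norm_sq_eq (y - x)]
    simp
  rw [hq]
  simp only [Fin.sum_univ_three]
  ring

/-- The regularization of the outgoing kernel in which `|y|` is replaced by `(|y|² + a)^{1/2}`, as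
a function of `q = |y|²` and up to the factor `1 / (4π)`. -/
noncomputable def radialProfile (k a q : ℝ) : ℂ :=
  Complex.exp (Complex.I * k * √(q + a)) / √(q + a)

/-- The derivative of `radialProfile` in `q`. -/
noncomputable def radialProfileDeriv (k a q : ℝ) : ℂ :=
  Complex.exp (Complex.I * k * √(q + a)) *
    (Complex.I * k / (2 * (√(q + a) : ℂ) ^ 2) - 1 / (2 * (√(q + a) : ℂ) ^ 3))

/-- The second derivative of `radialProfile` in `q`. -/
noncomputable def radialProfileDeriv₂ (k a q : ℝ) : ℂ :=
  Complex.exp (Complex.I * k * √(q + a)) *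
    (-k ^ 2 / (4 * (√(q + a) : ℂ) ^ 3) - 3 * Complex.I * k / (4 * (√(q + a) : ℂ) ^ 4)
      + 3 / (4 * (√(q + a) : ℂ) ^ 5))

theorem hasDerivAt_ofReal_sqrt_add {a q : ℝ} (h : 0 < q + a) :
    HasDerivAt (fun q : ℝ => (√(q + a) : ℂ)) (1 / (2 * (√(q + a) : ℂ))) q := by
  have h1 : HasDerivAt (fun q : ℝ => √(q + a)) (1 / (2 * √(q + a))) q :=
    ((hasDerivAt_id q).add_const a).sqrt h.ne'
  have := h1.ofReal_comp
  push_cast at this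
  exact this

theorem hasDerivAt_radialProfile (k : ℝ) {a q : ℝ} (h : 0 < q + a) :
    HasDerivAt (radialProfile k a) (radialProfileDeriv k a q) q := by
  have hs : (√(q + a) : ℂ) ≠ 0 := by exact_mod_cast (Real.sqrt_pos.2 h).ne'
  have d := hasDerivAt_ofReal_sqrt_add h
  have h1 := ((d.const_mul (Complex.I * k)).cexp).div d hs
  refine h1.congr_deriv ?_
  rw [radialProfileDeriv]
  field_simp

theorem hasDerivAt_radialProfileDeriv (k : ℝ) {a q : ℝ} (h : 0 < q + a) :
    HasDerivAt (radialProfileDeriv k a) (radialProfileDeriv₂ k a q) q := by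
  have hs : (√(q + a) : ℂ) ≠ 0 := by exact_mod_cast (Real.sqrt_pos.2 h).ne'
  have d := hasDerivAt_ofReal_sqrt_add h
  have h1 := ((d.const_mul (Complex.I * k)).cexp).mul
    (((hasDerivAt_const q (Complex.I * k)).div ((d.pow 2).const_mul 2) (by simpa using hs)).sub
      ((hasDerivAt_const q (1 : ℂ)).div ((d.pow 3).const_mul 2) (by simpa using hs)))
  refine h1.congr_deriv ?_
  rw [radialProfileDeriv₂]
  have hI : Complex.I ^ 2 = -1 := Complex.I_sq
  simp
  field_simp
  ring_nf
  simp only [hI]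
  ring

theorem contDiffAt_radialProfile (k : ℝ) {a : ℝ} {x y : E3} (h : 0 < ‖y - x‖ ^ 2 + a) {n : ℕ∞ω} :
    ContDiffAt ℝ n (fun z : E3 => radialProfile k a (‖z - x‖ ^ 2)) y := by
  have hs : (√(‖y - x‖ ^ 2 + a) : ℂ) ≠ 0 := by exact_mod_cast (Real.sqrt_pos.2 h).ne'
  have h0 : ContDiff ℝ n (fun z : E3 => ‖z - x‖ ^ 2 + a) :=
    ((contDiff_id.sub contDiff_const).norm_sq ℝ).add contDiff_const
  have h1 : ContDiffAt ℝ n (fun z : E3 => (√(‖z - x‖ ^ 2 + a) : ℂ)) y :=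
    Complex.ofRealCLM.contDiff.contDiffAt.comp y (h0.contDiffAt.sqrt h.ne')
  simp_rw [radialProfile, div_eq_mul_inv]
  exact ((contDiffAt_const.mul h1).cexp).mul (h1.inv hs)

/-- The regularized kernel solves the Helmholtz equation up to a concentrated error. -/
theorem laplacian_radialProfile (k : ℝ) {a : ℝ} {x y : E3} (h : 0 < ‖y - x‖ ^ 2 + a) :
    Δ (fun z : E3 => radialProfile k a (‖z - x‖ ^ 2)) y
        + (k : ℂ) ^ 2 * radialProfile k a (‖y - x‖ ^ 2)
      = -4 * a * radialProfileDeriv₂ k a (‖y - x‖ ^ 2) := by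
  have hs : (√(‖y - x‖ ^ 2 + a) : ℂ) ≠ 0 := by exact_mod_cast (Real.sqrt_pos.2 h).ne'
  rw [laplacian_radial (contDiffAt_radialProfile k h)
    ((lt_mem_nhds (show -a < ‖y - x‖ ^ 2 by linarith)).mono fun q hq =>
      hasDerivAt_radialProfile k (by linarith : 0 < q + a))
    (hasDerivAt_radialProfileDeriv k h)]
  have hq : (‖y - x‖ : ℂ) ^ 2 = (√(‖y - x‖ ^ 2 + a) : ℂ) ^ 2 - a := by
    have := Real.sq_sqrt h.le
    have h2 : ((√(‖y - x‖ ^ 2 + a) ^ 2 : ℝ) : ℂ) = ((‖y - x‖ ^ 2 + a : ℝ) : ℂ) := by rw [this]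
    push_cast at h2
    rw [h2]; ring
  rw [hq, radialProfile, radialProfileDeriv, radialProfileDeriv₂]
  field_simp
  ring

theorem helmholtzKernel_eq_radialProfile (k : ℝ) (x y : E3) :
    helmholtzKernel k (y - x) = 1 / (4 * Real.pi) * radialProfile k 0 (‖y - x‖ ^ 2) := by
  rw [helmholtzKernel, radialProfile, add_zero, Real.sqrt_sq (norm_nonneg _)]

theorem contDiffAt_helmholtzKernel (k : ℝ) {x y : E3} (h : y ≠ x) {n : ℕ∞ω} :
    ContDiffAt ℝ n (fun z : E3 => helmholtzKernel k (z - x)) y := by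
  simp_rw [helmholtzKernel_eq_radialProfile]
  refine contDiffAt_const.mul (contDiffAt_radialProfile k ?_)
  have : 0 < ‖y - x‖ := norm_pos_iff.2 (sub_ne_zero.2 h)
  positivity

theorem laplacian_helmholtzKernel (k : ℝ) {x y : E3} (h : y ≠ x) :
    Δ (fun z : E3 => helmholtzKernel k (z - x)) y = -(k : ℂ) ^ 2 * helmholtzKernel k (y - x) := by
  have hp : 0 < ‖y - x‖ ^ 2 + 0 := by
    have : 0 < ‖y - x‖ := norm_pos_iff.2 (sub_ne_zero.2 h)
    positivity
  simp_rw [helmholtzKernel_eq_radialProfile]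
  have h1 := InnerProductSpace.laplacian_smul (𝕜 := ℂ) (1 / (4 * Real.pi) : ℂ)
    (contDiffAt_radialProfile k hp (n := 2))
  have h2 : ((1 / (4 * Real.pi) : ℂ) • fun z : E3 => radialProfile k 0 (‖z - x‖ ^ 2)) =
    fun z : E3 => (1 / (4 * Real.pi) : ℂ) * radialProfile k 0 (‖z - x‖ ^ 2) := rfl
  rw [h2] at h1
  rw [h1, smul_eq_mul]
  have h3 := laplacian_radialProfile k hp
  simp only [Complex.ofReal_zero, mul_zero, zero_mul] at h3
  rw [eq_neg_of_add_eq_zero_left h3]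
  ring

theorem hasFDerivAt_helmholtzKernel (k : ℝ) {x y : E3} (h : y ≠ x) :
    HasFDerivAt (fun z : E3 => helmholtzKernel k (z - x))
      ((innerSL ℝ (y - x)).smulRight (helmholtzKernel k (y - x) *
        (Complex.I * k / ‖y - x‖ - 1 / (‖y - x‖ : ℂ) ^ 2))) y := by
  have hn : 0 < ‖y - x‖ := norm_pos_iff.2 (sub_ne_zero.2 h)
  have hnC : (‖y - x‖ : ℂ) ≠ 0 := by exact_mod_cast hn.ne'
  have hp : 0 < ‖y - x‖ ^ 2 + 0 := by positivity
  have h1 := (hasFDerivAt_radial (hasDerivAt_radialProfile k hp)).const_mul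
    (1 / (4 * Real.pi) : ℂ)
  simp_rw [helmholtzKernel_eq_radialProfile]
  refine h1.congr_fderiv ?_
  ext v
  have hpi : (Real.pi : ℂ) ≠ 0 := by exact_mod_cast Real.pi_ne_zero
  simp only [radialProfile, radialProfileDeriv, add_zero, Real.sqrt_sq hn.le]
  simp
  field_simp

/-! ### Regularized kernels as an approximate identity -/

theorem laplacian_comp_sub (f : E3 → ℂ) (x y : E3) : Δ (fun z => f (z - x)) y = Δ f (y - x) := by
  rw [laplacian_eq_sum_fderiv, laplacian_eq_sum_fderiv]
  have h : fderiv ℝ (fun z => f (z - x)) = fun z => fderiv ℝ f (z - x) := by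
    funext z; exact fderiv_comp_sub x
  rw [h]
  refine Finset.sum_congr rfl fun i _ => ?_
  rw [fderiv_comp_sub (f := fderiv ℝ f) x]

theorem ContDiff.continuous_laplacian {f : E3 → ℂ} (hf : ContDiff ℝ 2 f) : Continuous (Δ f) := by
  have h : Δ f = fun x => ∑ i, fderiv ℝ (fderiv ℝ f) x (stdVec i) (stdVec i) :=
    funext fun x => laplacian_eq_sum_fderiv f x
  rw [h]
  have h1 : ContDiff ℝ 1 (fderiv ℝ f) := hf.fderiv_right (by norm_num)
  have h2 := h1.continuous_fderiv one_ne_zero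
  fun_prop

theorem ContDiff.laplacian_smooth {f : E3 → ℂ} (hf : ContDiff ℝ ∞ f) : ContDiff ℝ ∞ (Δ f) := by
  have h : Δ f = fun x => ∑ i, fderiv ℝ (fderiv ℝ f) x (stdVec i) (stdVec i) :=
    funext fun x => laplacian_eq_sum_fderiv f x
  rw [h]
  have h1 : ContDiff ℝ ∞ (fderiv ℝ f) := hf.fderiv_right (by simp)
  have h2 : ContDiff ℝ ∞ (fderiv ℝ (fderiv ℝ f)) := h1.fderiv_right (by simp)
  exact ContDiff.sum fun i _ => (h2.clm_apply contDiff_const).clm_apply contDiff_const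

theorem laplacian_eq_zero_of_notMem_tsupport {f : E3 → ℂ} {x : E3} (hx : x ∉ tsupport f) :
    Δ f x = 0 := by
  have h : f =ᶠ[𝓝 x] fun _ => (0 : ℂ) := notMem_tsupport_iff_eventuallyEq.1 hx
  rw [(InnerProductSpace.laplacian_congr_nhds h).eq_of_nhds]
  simp [laplacian_eq_sum_fderiv]

/-- The terms of `(Δ + k²)(X · radialProfile)` that involve derivatives of the cutoff `X`. -/
noncomputable def cutoffError (X : E3 → ℂ) (k a : ℝ) (z : E3) : ℂ :=
  2 * ∑ i, fderiv ℝ X z (stdVec i) * (2 * z i * radialProfileDeriv k a (‖z‖ ^ 2))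
    + radialProfile k a (‖z‖ ^ 2) * Δ X z

theorem laplacian_cutoff_mul_radialProfile {X : E3 → ℂ} (hX : ContDiff ℝ 2 X) (k : ℝ) {a : ℝ}
    (ha : 0 < a) (z : E3) :
    Δ (fun y => X y * radialProfile k a (‖y‖ ^ 2)) z
        + (k : ℂ) ^ 2 * (X z * radialProfile k a (‖z‖ ^ 2))
      = cutoffError X k a z - X z * (4 * a * radialProfileDeriv₂ k a (‖z‖ ^ 2)) := by
  have hp : 0 < ‖z - 0‖ ^ 2 + a := by positivity
  have hR : ContDiffAt ℝ 2 (fun y : E3 => radialProfile k a (‖y‖ ^ 2)) z := by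
    simpa using contDiffAt_radialProfile k hp (n := 2)
  have hL := laplacian_radialProfile k hp
  have hd := (hasFDerivAt_radial (hasDerivAt_radialProfile k hp)).fderiv
  simp only [sub_zero] at hL hd
  rw [hX.contDiffAt.laplacian_mul hR, hd, cutoffError]
  have hs : ∀ i, (((2 : ℝ) • innerSL ℝ z).smulRight (radialProfileDeriv k a (‖z‖ ^ 2)))
      (stdVec i) = 2 * z i * radialProfileDeriv k a (‖z‖ ^ 2) := by
    intro i
    simp [inner_stdVec]
  simp_rw [hs]
  linear_combination X z * hL

theorem continuousAt_radialProfile_param (k : ℝ) {p : ℝ × ℝ} (hp : 0 < p.2 + p.1) :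
    ContinuousAt (fun p : ℝ × ℝ => radialProfile k p.1 p.2) p ∧
      ContinuousAt (fun p : ℝ × ℝ => radialProfileDeriv k p.1 p.2) p := by
  have hs : (√(p.2 + p.1) : ℂ) ≠ 0 := by exact_mod_cast (Real.sqrt_pos.2 hp).ne'
  have hc : ContinuousAt (fun p : ℝ × ℝ => (√(p.2 + p.1) : ℂ)) p := by fun_prop
  constructor
  · exact ((continuousAt_const.mul hc).cexp).div hc hs
  · exact ((continuousAt_const.mul hc).cexp).mul
      ((continuousAt_const.div (continuousAt_const.mul (hc.pow 2)) (by simpa using hs)).sub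
        (continuousAt_const.div (continuousAt_const.mul (hc.pow 3)) (by simpa using hs)))

theorem contDiffAt_radialProfileDeriv (k : ℝ) {y : E3} (h : y ≠ 0) :
    ContDiffAt ℝ ∞ (fun z : E3 => radialProfileDeriv k 0 (‖z‖ ^ 2)) y := by
  have hpos : 0 < ‖y‖ ^ 2 + 0 := by have := norm_pos_iff.2 h; positivity
  have hs : (√(‖y‖ ^ 2 + 0) : ℂ) ≠ 0 := by exact_mod_cast (Real.sqrt_pos.2 hpos).ne'
  have h0 : ContDiff ℝ ∞ (fun z : E3 => ‖z‖ ^ 2 + 0) :=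
    ((contDiff_id (E := E3)).norm_sq ℝ).add contDiff_const
  have h1 : ContDiffAt ℝ ∞ (fun z : E3 => (√(‖z‖ ^ 2 + 0) : ℂ)) y :=
    Complex.ofRealCLM.contDiff.contDiffAt.comp y (h0.contDiffAt.sqrt hpos.ne')
  simp_rw [radialProfileDeriv, div_eq_mul_inv]
  exact ((contDiffAt_const.mul h1).cexp).mul
    ((contDiffAt_const.mul ((contDiffAt_const.mul (h1.pow 2)).inv (by simpa using hs))).sub
      (contDiffAt_const.mul ((contDiffAt_const.mul (h1.pow 3)).inv (by simpa using hs))))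

theorem cutoffError_eq_zero {X : E3 → ℂ} {c : ℂ} {z : E3} (hz : X =ᶠ[𝓝 z] fun _ => c) (k a : ℝ) :
    cutoffError X k a z = 0 := by
  have h1 : fderiv ℝ X z = 0 := by rw [hz.fderiv_eq]; simp
  have h2 : Δ X z = 0 := by
    rw [(InnerProductSpace.laplacian_congr_nhds hz).eq_of_nhds]
    simp [laplacian_eq_sum_fderiv]
  simp [cutoffError, h1, h2]

theorem continuous_cutoffError {X : E3 → ℂ} (hX : ContDiff ℝ ∞ X) (hX1 : X =ᶠ[𝓝 0] fun _ => 1)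
    (k : ℝ) : Continuous (fun p : ℝ × E3 => cutoffError X k (p.1 ^ 2) p.2) := by
  rw [continuous_iff_continuousAt]
  rintro ⟨ε, z⟩
  by_cases hz : z = 0
  · subst hz
    have h : (fun p : ℝ × E3 => cutoffError X k (p.1 ^ 2) p.2) =ᶠ[𝓝 (ε, 0)] fun _ => 0 := by
      have h1 := (continuous_snd.tendsto ((ε, 0) : ℝ × E3)).eventually hX1.eventuallyEq_nhds
      filter_upwards [h1] with p hp
      exact cutoffError_eq_zero hp k _
    exact continuousAt_const.congr h.symm
  · have hp : 0 < ‖z‖ ^ 2 + ε ^ 2 := by have := norm_pos_iff.2 hz; positivity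
    have hm : Continuous fun p : ℝ × E3 => (p.1 ^ 2, ‖p.2‖ ^ 2) := by fun_prop
    have hc := continuousAt_radialProfile_param k (p := (ε ^ 2, ‖z‖ ^ 2)) hp
    have c1 : ContinuousAt (fun p : ℝ × E3 => radialProfile k (p.1 ^ 2) (‖p.2‖ ^ 2)) (ε, z) :=
      ContinuousAt.comp (x := ((ε, z) : ℝ × E3))
        (f := fun p : ℝ × E3 => (p.1 ^ 2, ‖p.2‖ ^ 2)) hc.1 hm.continuousAt
    have c2 : ContinuousAt (fun p : ℝ × E3 => radialProfileDeriv k (p.1 ^ 2) (‖p.2‖ ^ 2)) (ε, z) :=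
      ContinuousAt.comp (x := ((ε, z) : ℝ × E3))
        (f := fun p : ℝ × E3 => (p.1 ^ 2, ‖p.2‖ ^ 2)) hc.2 hm.continuousAt
    have c3 : Continuous fun p : ℝ × E3 => Δ X p.2 :=
      (hX.of_le ENat.LEInfty.out).continuous_laplacian.comp continuous_snd
    have c4 : ∀ i, Continuous fun p : ℝ × E3 => fderiv ℝ X p.2 (stdVec i) := fun i =>
      ((hX.continuous_fderiv (by simp)).comp continuous_snd).clm_apply continuous_const
    have c5 : ∀ i, Continuous fun p : ℝ × E3 => (2 * p.2 i : ℂ) := fun i => by fun_prop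
    unfold cutoffError
    refine (continuousAt_const.mul (tendsto_finsetSum _ fun i _ => ?_)).add
      (c1.mul c3.continuousAt)
    exact (c4 i).continuousAt.mul ((c5 i).continuousAt.mul c2)

theorem contDiff_cutoffError {X : E3 → ℂ} (hX : ContDiff ℝ ∞ X) (hX1 : X =ᶠ[𝓝 0] fun _ => 1)
    (k : ℝ) : ContDiff ℝ ∞ (cutoffError X k 0) := by
  rw [contDiff_iff_contDiffAt]
  intro z
  by_cases hz : z = 0
  · subst hz
    have h : cutoffError X k 0 =ᶠ[𝓝 0] fun _ => 0 := by
      filter_upwards [hX1.eventuallyEq_nhds] with p hp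
      exact cutoffError_eq_zero hp k _
    exact contDiffAt_const.congr_of_eventuallyEq h
  · have hp : 0 < ‖z - 0‖ ^ 2 + 0 := by have := norm_pos_iff.2 hz; rw [sub_zero]; positivity
    have c1 := contDiffAt_radialProfile k hp (n := ∞)
    simp only [sub_zero] at c1
    have c2 := contDiffAt_radialProfileDeriv k hz
    have c4 : ContDiff ℝ ∞ (fderiv ℝ X) := hX.fderiv_right (by simp)
    have c5 : ∀ i, ContDiff ℝ ∞ fun p : E3 => (p i : ℂ) := fun i =>
      Complex.ofRealCLM.contDiff.comp (EuclideanSpace.proj (𝕜 := ℝ) i).contDiff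
    unfold cutoffError
    refine (contDiffAt_const.mul (ContDiffAt.sum fun i _ => ?_)).add
      (c1.mul hX.laplacian_smooth.contDiffAt)
    exact (c4.clm_apply contDiff_const).contDiffAt.mul
      ((contDiffAt_const.mul (c5 i).contDiffAt).mul c2)

theorem HasCompactSupport.cutoffError {X : E3 → ℂ} (hX : HasCompactSupport X) (k a : ℝ) :
    HasCompactSupport (_root_.cutoffError X k a) := by
  refine hX.mono' fun z hz => ?_
  by_contra h
  exact hz (cutoffError_eq_zero (notMem_tsupport_iff_eventuallyEq.1 h) k a)

/-- The concentrated error `4 ε² radialProfileDeriv₂`, rescaled by `z = ε ζ`. -/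
theorem rescaled_concentrated_error (k : ℝ) {ε : ℝ} (hε : 0 < ε) (ζ : E3) :
    (ε : ℂ) ^ 3 * (4 * (ε ^ 2 : ℝ) * radialProfileDeriv₂ k (ε ^ 2) (‖ε • ζ‖ ^ 2)) =
      Complex.exp (Complex.I * k * (ε * √(1 + ‖ζ‖ ^ 2) : ℝ)) *
        (3 - 3 * Complex.I * k * (ε * √(1 + ‖ζ‖ ^ 2) : ℝ) - k ^ 2 * (ε * √(1 + ‖ζ‖ ^ 2) : ℝ) ^ 2)
        * ((√(1 + ‖ζ‖ ^ 2) : ℂ) ^ 5)⁻¹ := by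
  have hs : √(‖ε • ζ‖ ^ 2 + ε ^ 2) = ε * √(1 + ‖ζ‖ ^ 2) := by
    rw [norm_smul, Real.norm_of_nonneg hε.le,
      show (ε * ‖ζ‖) ^ 2 + ε ^ 2 = ε ^ 2 * (1 + ‖ζ‖ ^ 2) by ring, Real.sqrt_mul (sq_nonneg ε),
      Real.sqrt_sq hε.le]
  have ht : (√(1 + ‖ζ‖ ^ 2) : ℂ) ≠ 0 := by
    have : 0 < √(1 + ‖ζ‖ ^ 2) := Real.sqrt_pos.2 (by positivity)
    exact_mod_cast this.ne'
  have hεC : (ε : ℂ) ≠ 0 := by exact_mod_cast hε.ne'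
  rw [radialProfileDeriv₂, hs]
  push_cast
  field_simp
  ring

theorem integrable_inv_sqrt_pow_five :
    Integrable fun ζ : E3 => (√(1 + ‖ζ‖ ^ 2) ^ 5)⁻¹ := by
  have h := integrable_rpow_neg_one_add_norm_sq (E := E3) (μ := volume) (r := 5) (by
    rw [finrank_euclideanSpace_fin]; norm_num)
  refine h.congr (Eventually.of_forall fun ζ => ?_)
  simp only
  rw [show (-5 / 2 : ℝ) = -(5 / 2) by norm_num, Real.rpow_neg (by positivity), Real.sqrt_eq_rpow,
    ← Real.rpow_mul_natCast (by positivity)]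
  norm_num

/-- The regularized kernels form an approximate identity, up to the constant
`∫ 3 (1 + |ζ|²)^{-5/2} dζ`, which is `4π`; only that it is not zero is needed. -/
theorem tendsto_concentrated_error {X w : E3 → ℂ} (hXc : HasCompactSupport X) (hX : Continuous X)
    (hX1 : X 0 = 1) (hw : Continuous w) (k : ℝ) (x : E3) :
    Tendsto (fun ε : ℝ => ∫ z, w (x + z) *
        (X z * (4 * (ε ^ 2 : ℝ) * radialProfileDeriv₂ k (ε ^ 2) (‖z‖ ^ 2))))
      (𝓝[>] 0) (𝓝 (w x * (3 * ∫ ζ : E3, (√(1 + ‖ζ‖ ^ 2) ^ 5)⁻¹ : ℝ))) := by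
  set t : E3 → ℝ := fun ζ => √(1 + ‖ζ‖ ^ 2) with ht
  set m : ℝ → E3 → ℂ := fun ε ζ => Complex.exp (Complex.I * k * (ε * t ζ : ℝ)) *
        (3 - 3 * Complex.I * k * (ε * t ζ : ℝ) - k ^ 2 * (ε * t ζ : ℝ) ^ 2)
        * ((t ζ : ℂ) ^ 5)⁻¹ with hm
  have ht1 : ∀ ζ, 1 ≤ t ζ := fun ζ => by
    rw [ht]; simp only; rw [Real.one_le_sqrt]; nlinarith [sq_nonneg ‖ζ‖]
  have htc : Continuous t := by fun_prop
  -- The substitution `z = ε ζ`.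
  have hscale : ∀ᶠ ε : ℝ in 𝓝[>] 0, ∫ ζ, w (x + ε • ζ) * X (ε • ζ) * m ε ζ =
      ∫ z, w (x + z) * (X z * (4 * (ε ^ 2 : ℝ) * radialProfileDeriv₂ k (ε ^ 2) (‖z‖ ^ 2))) := by
    filter_upwards [self_mem_nhdsWithin] with ε hε
    have hε' : (0 : ℝ) < ε := hε
    have h := Measure.integral_comp_smul (volume : Measure E3) (fun z => w (x + z) *
      (X z * (4 * (ε ^ 2 : ℝ) * radialProfileDeriv₂ k (ε ^ 2) (‖z‖ ^ 2)))) ε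
    rw [finrank_euclideanSpace_fin, abs_of_pos (by positivity), Complex.real_smul] at h
    have hεC : (ε : ℂ) ≠ 0 := by exact_mod_cast hε'.ne'
    have h2 : ∫ z, w (x + z) * (X z * (4 * (ε ^ 2 : ℝ) * radialProfileDeriv₂ k (ε ^ 2) (‖z‖ ^ 2)))
      = (ε : ℂ) ^ 3 * ∫ ζ, w (x + ε • ζ) * (X (ε • ζ) * (4 * (ε ^ 2 : ℝ) *
        radialProfileDeriv₂ k (ε ^ 2) (‖ε • ζ‖ ^ 2))) := by
      rw [h, ← mul_assoc]; push_cast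
      rw [mul_inv_cancel₀ (pow_ne_zero 3 hεC), one_mul]
    rw [h2, ← integral_const_mul]
    refine integral_congr_ae (Eventually.of_forall fun ζ => ?_)
    simp only [hm]
    rw [← rescaled_concentrated_error k hε' ζ]
    ring
  refine Tendsto.congr' hscale ?_
  obtain ⟨δ, hδ⟩ := hXc.isCompact.isBounded.exists_norm_le
  obtain ⟨M, hM⟩ : ∃ M, ∀ z, ‖w (x + z) * X z‖ ≤ M := by
    have hc : HasCompactSupport fun z => w (x + z) * X z := hXc.mul_left
    exact (show Continuous fun z => w (x + z) * X z by fun_prop).bounded_above_of_compact_support hc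
  have hM0 : 0 ≤ M := (norm_nonneg _).trans (hM 0)
  set B : ℝ := |δ| + 1 with hB
  have hB0 : 0 ≤ B := by positivity
  set Q : ℝ := 3 + 3 * |k| * B + k ^ 2 * B ^ 2 with hQ
  have hint := integrable_inv_sqrt_pow_five
  have hlimint : (w x * (3 * ∫ ζ : E3, (t ζ ^ 5)⁻¹ : ℝ) : ℂ)
      = ∫ ζ, w x * ((3 * (t ζ ^ 5)⁻¹ : ℝ) : ℂ) := by
    rw [integral_const_mul, ← integral_const_mul (3 : ℝ)]
    congr 1
    exact (integral_ofReal (𝕜 := ℂ)).symm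
  rw [hlimint]
  refine tendsto_integral_filter_of_dominated_convergence (fun ζ => M * Q * (t ζ ^ 5)⁻¹) ?_ ?_
    (hint.const_mul _) ?_
  · refine Eventually.of_forall fun ε => Continuous.aestronglyMeasurable ?_
    have : ∀ ζ, ((t ζ : ℂ) ^ 5) ≠ 0 := fun ζ => by
      have := zero_lt_one.trans_le (ht1 ζ)
      exact pow_ne_zero _ (by exact_mod_cast this.ne')
    have h1 : Continuous fun ζ => ((t ζ : ℂ) ^ 5)⁻¹ :=
      Continuous.inv₀ (by fun_prop) this
    simp only [hm]
    fun_prop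
  · filter_upwards [Ioo_mem_nhdsGT (zero_lt_one (α := ℝ))] with ε hε
    refine Eventually.of_forall fun ζ => ?_
    have htp := zero_lt_one.trans_le (ht1 ζ)
    have hnn : ‖((t ζ : ℂ) ^ 5)⁻¹‖ = (t ζ ^ 5)⁻¹ := by
      rw [norm_inv, norm_pow, Complex.norm_real, Real.norm_of_nonneg htp.le]
    -- The cutoff keeps `ε t(ζ)` bounded, so that the decay `t(ζ)⁻⁵` dominates.
    by_cases hζ : ε • ζ ∈ tsupport X
    · have hεζ : ε * ‖ζ‖ ≤ |δ| := by
        have := hδ _ hζ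
        rw [norm_smul, Real.norm_of_nonneg hε.1.le] at this
        exact this.trans (le_abs_self δ)
      have hεt : ε * t ζ ≤ B := by
        have h1 : t ζ ≤ 1 + ‖ζ‖ := by
          rw [ht]; simp only
          rw [Real.sqrt_le_left (by positivity)]
          nlinarith [norm_nonneg ζ]
        calc ε * t ζ ≤ ε * (1 + ‖ζ‖) := by gcongr; exact hε.1.le
          _ = ε + ε * ‖ζ‖ := by ring
          _ ≤ 1 + |δ| := by linarith [hε.2]
          _ = B := by ring
      have hεt0 : 0 ≤ ε * t ζ := mul_nonneg hε.1.le htp.le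
      have hexp : ‖Complex.exp (Complex.I * k * (ε * t ζ : ℝ))‖ = 1 := by
        rw [show Complex.I * k * (ε * t ζ : ℝ) = ((k * (ε * t ζ) : ℝ) : ℂ) * Complex.I by
          push_cast; ring]
        exact Complex.norm_exp_ofReal_mul_I _
      have hpoly : ‖(3 - 3 * Complex.I * k * (ε * t ζ : ℝ) - k ^ 2 * (ε * t ζ : ℝ) ^ 2 : ℂ)‖
          ≤ Q := by
        calc _ ≤ ‖(3 : ℂ)‖ + ‖3 * Complex.I * k * (ε * t ζ : ℝ)‖
              + ‖(k ^ 2 * (ε * t ζ : ℝ) ^ 2 : ℂ)‖ :=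
            (norm_sub_le _ _).trans (by gcongr; exact norm_sub_le _ _)
          _ = 3 + 3 * |k| * (ε * t ζ) + k ^ 2 * (ε * t ζ) ^ 2 := by
            simp only [norm_mul, norm_pow, Complex.norm_real, Complex.norm_I, Real.norm_eq_abs,
              sq_abs, abs_of_nonneg hε.1.le, abs_of_nonneg htp.le]
            norm_num
          _ ≤ Q := by rw [hQ]; gcongr
      have hmn : ‖m ε ζ‖ ≤ Q * (t ζ ^ 5)⁻¹ := by
        simp only [hm]
        rw [norm_mul, norm_mul, hexp, hnn, one_mul]
        gcongr
      rw [norm_mul (w _ * X _), mul_assoc]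
      exact mul_le_mul (hM _) hmn (norm_nonneg _) hM0
    · have hQ0 : 0 ≤ Q := by positivity
      rw [image_eq_zero_of_notMem_tsupport hζ, mul_zero, zero_mul, norm_zero]
      positivity
  · refine Eventually.of_forall fun ζ => ?_
    have hc : Continuous fun ε : ℝ => w (x + ε • ζ) * X (ε • ζ) * m ε ζ := by
      simp only [hm]
      fun_prop
    have h := (hc.tendsto 0).mono_left (nhdsWithin_le_nhds (s := Set.Ioi 0))
    convert h using 2
    simp [hm, hX1]

/-! ### Interior regularity for the Helmholtz equation -/

theorem tsupport_ofReal_subset (χ : E3 → ℝ) : tsupport (fun y => (χ y : ℂ)) ⊆ tsupport χ :=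
  tsupport_comp_subset Complex.ofReal_zero χ

theorem integral_inv_sqrt_pow_five_pos : 0 < ∫ ζ : E3, (√(1 + ‖ζ‖ ^ 2) ^ 5)⁻¹ := by
  have hpos : ∀ ζ : E3, 0 < (√(1 + ‖ζ‖ ^ 2) ^ 5)⁻¹ := fun ζ => by positivity
  rw [integral_pos_iff_support_of_nonneg (fun ζ => (hpos ζ).le) integrable_inv_sqrt_pow_five]
  have : Function.support (fun ζ : E3 => (√(1 + ‖ζ‖ ^ 2) ^ 5)⁻¹) = Set.univ :=
    Set.eq_univ_of_forall fun ζ => (hpos ζ).ne'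
  rw [this]
  exact isOpen_univ.measure_pos volume Set.univ_nonempty

/-- The weak equation tested with a truncated regularized kernel. -/
theorem weak_helmholtz_truncated_kernel {k : ℝ} {w F : E3 → ℂ} (hw : Continuous w)
    (hweak : ∀ φ : E3 → ℂ, ContDiff ℝ ∞ φ → HasCompactSupport φ →
      (∫ x, w x * (Δ φ x + (k : ℂ) ^ 2 * φ x)) + ∫ x, F x * φ x = 0)
    {X : E3 → ℂ} (hX : ContDiff ℝ ∞ X) (hXc : HasCompactSupport X) {x : E3}
    (hF : ∀ᵐ y, y - x ∈ tsupport X → F y = 0) {a : ℝ} (ha : 0 < a)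
    (hce : Continuous (cutoffError X k a)) :
    ∫ z, w (x + z) * cutoffError X k a z =
      ∫ z, w (x + z) * (X z * (4 * a * radialProfileDeriv₂ k a (‖z‖ ^ 2))) := by
  obtain ⟨P, hP⟩ : ∃ P : E3 → ℂ, P = fun z => X z * radialProfile k a (‖z‖ ^ 2) := ⟨_, rfl⟩
  have hR : ContDiff ℝ ∞ fun z : E3 => radialProfile k a (‖z‖ ^ 2) := by
    rw [contDiff_iff_contDiffAt]
    intro z
    have h : 0 < ‖z - 0‖ ^ 2 + a := by positivity
    simpa using contDiffAt_radialProfile k h (n := ∞)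
  have hPd : ContDiff ℝ ∞ P := by rw [hP]; exact hX.mul hR
  have hPc : HasCompactSupport P := by rw [hP]; exact hXc.mul_right
  have hPL : ∀ z, Δ P z + (k : ℂ) ^ 2 * P z =
      cutoffError X k a z - X z * (4 * a * radialProfileDeriv₂ k a (‖z‖ ^ 2)) := fun z => by
    rw [hP]; exact laplacian_cutoff_mul_radialProfile (hX.of_le ENat.LEInfty.out) k ha z
  have hφd : ContDiff ℝ ∞ fun y => P (y - x) := hPd.comp (contDiff_id.sub contDiff_const)
  have hφc : HasCompactSupport fun y => P (y - x) :=
    hPc.comp_homeomorph (Homeomorph.subRight x)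
  have h := hweak _ hφd hφc
  have hF0 : ∫ y, F y * P (y - x) = 0 := by
    rw [← integral_zero E3 ℂ]
    refine integral_congr_ae ?_
    filter_upwards [hF] with y hy
    by_cases hyX : y - x ∈ tsupport X
    · rw [hy hyX, zero_mul]
    · simp only [hP, image_eq_zero_of_notMem_tsupport hyX, zero_mul, mul_zero]
  rw [hF0, add_zero, ← integral_add_left_eq_self _ x] at h
  simp only [laplacian_comp_sub, add_sub_cancel_left] at h
  simp_rw [hPL, mul_sub] at h
  have hw' : Continuous fun z => w (x + z) := by fun_prop
  have hconc : Continuous fun z : E3 =>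
      X z * (4 * a * radialProfileDeriv₂ k a (‖z‖ ^ 2)) := by
    have h1 : ∀ z, X z * (4 * a * radialProfileDeriv₂ k a (‖z‖ ^ 2)) =
        cutoffError X k a z - (Δ P z + (k : ℂ) ^ 2 * P z) := fun z => by
      rw [hPL]; ring
    simp_rw [h1]
    exact hce.sub ((hPd.of_le ENat.LEInfty.out).continuous_laplacian.add
      (continuous_const.mul hPd.continuous))
  rw [integral_sub, sub_eq_zero] at h
  · exact h
  · exact (hw'.mul hce).integrable_of_hasCompactSupport (hXc.cutoffError k _).mul_left
  · exact (hw'.mul hconc).integrable_of_hasCompactSupport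
      (HasCompactSupport.mul_left (HasCompactSupport.mul_right hXc))

/-- A mean value property: away from the support of `F`, the solution is a constant multiple of its
integral against a smooth compactly supported kernel. It is the weak equation tested with
truncations of the regularized kernels, in the limit. -/
theorem weak_helmholtz_mean_value {k : ℝ} {w F : E3 → ℂ} (hw : Continuous w)
    (hweak : ∀ φ : E3 → ℂ, ContDiff ℝ ∞ φ → HasCompactSupport φ →
      (∫ x, w x * (Δ φ x + (k : ℂ) ^ 2 * φ x)) + ∫ x, F x * φ x = 0)
    {X : E3 → ℂ} (hX : ContDiff ℝ ∞ X) (hXc : HasCompactSupport X) (hX1 : X =ᶠ[𝓝 0] fun _ => 1)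
    {x : E3} (hF : ∀ᵐ y, y - x ∈ tsupport X → F y = 0) :
    w x * (3 * ∫ ζ : E3, (√(1 + ‖ζ‖ ^ 2) ^ 5)⁻¹ : ℝ) = ∫ z, w (x + z) * cutoffError X k 0 z := by
  have hcont := continuous_cutoffError hX hX1 k
  have hIc : Continuous fun ε : ℝ => ∫ z, w (x + z) * cutoffError X k (ε ^ 2) z := by
    have hf : Continuous fun p : ℝ × E3 => w (x + p.2) * cutoffError X k (p.1 ^ 2) p.2 :=
      (show Continuous fun p : ℝ × E3 => w (x + p.2) by fun_prop).mul hcont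
    have h := continuous_parametric_integral_of_continuous (μ := (volume : Measure E3))
      (f := fun (ε : ℝ) z => w (x + z) * cutoffError X k (ε ^ 2) z) hf
      (s := tsupport X) hXc
    have he : ∀ ε : ℝ, ∫ z in tsupport X, w (x + z) * cutoffError X k (ε ^ 2) z =
        ∫ z, w (x + z) * cutoffError X k (ε ^ 2) z := fun ε => by
      refine setIntegral_eq_integral_of_forall_compl_eq_zero fun z hz => ?_
      rw [cutoffError_eq_zero (notMem_tsupport_iff_eventuallyEq.1 hz), mul_zero]
    exact h.congr he
  have hlim := (hIc.tendsto 0).mono_left (nhdsWithin_le_nhds (s := Set.Ioi 0))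
  rw [show (0 : ℝ) ^ 2 = 0 by norm_num] at hlim
  have hlim' := tendsto_concentrated_error hXc hX.continuous hX1.eq_of_nhds hw k x
  have he : (fun ε : ℝ => ∫ z, w (x + z) * cutoffError X k (ε ^ 2) z) =ᶠ[𝓝[>] 0]
      fun ε : ℝ => ∫ z, w (x + z) *
        (X z * (4 * (ε ^ 2 : ℝ) * radialProfileDeriv₂ k (ε ^ 2) (‖z‖ ^ 2))) := by
    filter_upwards [self_mem_nhdsWithin] with ε hε
    have hε2 : 0 < ε ^ 2 := pow_pos hε 2
    have hpair : Continuous fun z : E3 => (ε, z) := by fun_prop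
    have hce := hcont.comp hpair
    simp only [Function.comp_def] at hce
    exact weak_helmholtz_truncated_kernel hw hweak hX hXc hF hε2 hce
  exact tendsto_nhds_unique hlim' (hlim.congr' he)

/-- Interior regularity (Weyl's lemma) for the Helmholtz equation. -/
theorem weak_helmholtz_contDiffAt {k : ℝ} {w F : E3 → ℂ} (hw : Continuous w)
    (hweak : ∀ φ : E3 → ℂ, ContDiff ℝ ∞ φ → HasCompactSupport φ →
      (∫ x, w x * (Δ φ x + (k : ℂ) ^ 2 * φ x)) + ∫ x, F x * φ x = 0)
    {S : Set E3} (hS : IsClosed S) (hF : ∀ᵐ x, x ∉ S → F x = 0) {x₀ : E3} (hx₀ : x₀ ∉ S) :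
    ContDiffAt ℝ ∞ w x₀ := by
  obtain ⟨δ, hδ, hball⟩ := Metric.isOpen_iff.1 hS.isOpen_compl x₀ hx₀
  obtain ⟨χ, hχ, hχc, hχs, hχ1, -⟩ := exists_smooth_cutoff (isCompact_singleton (x := (0 : E3)))
    (Metric.isOpen_ball (x := (0 : E3)) (ε := δ / 2))
    (Set.singleton_subset_iff.2 (Metric.mem_ball_self (by positivity)))
  set X : E3 → ℂ := fun y => (χ y : ℂ) with hX
  have hXd : ContDiff ℝ ∞ X := Complex.ofRealCLM.contDiff.comp hχ
  have hXc : HasCompactSupport X := hχc.comp_left (g := fun t : ℝ => (t : ℂ)) rfl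
  have hXs : tsupport X ⊆ Metric.ball 0 (δ / 2) :=
    (tsupport_ofReal_subset χ).trans hχs
  have hX1 : X =ᶠ[𝓝 0] fun _ => 1 := by
    filter_upwards [hχ1 0 rfl] with y hy
    simp [hX, hy]
  set c : ℂ := ((3 * ∫ ζ : E3, (√(1 + ‖ζ‖ ^ 2) ^ 5)⁻¹ : ℝ) : ℂ) with hc
  have hc0 : c ≠ 0 := by
    have := integral_inv_sqrt_pow_five_pos
    rw [hc]
    exact_mod_cast (by positivity : (0 : ℝ) < 3 * ∫ ζ : E3, (√(1 + ‖ζ‖ ^ 2) ^ 5)⁻¹).ne'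
  set g : E3 → ℂ := fun t => cutoffError X k 0 (-t) with hg
  have hgd : ContDiff ℝ ∞ g := (contDiff_cutoffError hXd hX1 k).comp contDiff_neg
  have hgc : HasCompactSupport g := (hXc.cutoffError k 0).comp_homeomorph (Homeomorph.neg E3)
  have hconv : ContDiff ℝ ∞ (convolution w g (ContinuousLinearMap.mul ℝ ℂ) volume) :=
    hgc.contDiff_convolution_right _ hw.locallyIntegrable hgd
  have heq : w =ᶠ[𝓝 x₀] fun x => c⁻¹ * convolution w g (ContinuousLinearMap.mul ℝ ℂ) volume x := by
    filter_upwards [Metric.ball_mem_nhds x₀ (show 0 < δ / 2 by positivity)] with x hx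
    have hFx : ∀ᵐ y, y - x ∈ tsupport X → F y = 0 := by
      filter_upwards [hF] with y hy hyX
      refine hy (hball ?_)
      have h1 := mem_ball_zero_iff.1 (hXs hyX)
      rw [Metric.mem_ball] at hx ⊢
      calc dist y x₀ ≤ dist y x + dist x x₀ := dist_triangle _ _ _
        _ < δ / 2 + δ / 2 := by rw [dist_eq_norm y x]; gcongr
        _ = δ := by ring
    have h := weak_helmholtz_mean_value hw hweak hXd hXc hX1 hFx
    have h2 : convolution w g (ContinuousLinearMap.mul ℝ ℂ) volume x = w x * c := by
      rw [h, convolution_def, ← integral_add_left_eq_self _ x]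
      simp [hg]
    rw [h2]
    field_simp
  exact (contDiffAt_const.mul hconv.contDiffAt).congr_of_eventuallyEq heq

/-- Multiplying by a cutoff that vanishes near the singular set gives a smooth function. -/
theorem contDiff_mul_of_tsupport {f g : E3 → ℂ} {n : ℕ∞ω} (hf : ContDiff ℝ n f)
    (hg : ∀ x ∈ tsupport f, ContDiffAt ℝ n g x) : ContDiff ℝ n fun x => f x * g x := by
  rw [contDiff_iff_contDiffAt]
  intro x
  by_cases hx : x ∈ tsupport f
  · exact hf.contDiffAt.mul (hg x hx)
  · have h : (fun x => f x * g x) =ᶠ[𝓝 x] fun _ => 0 := by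
      filter_upwards [notMem_tsupport_iff_eventuallyEq.1 hx] with y hy
      simp [hy]
    exact contDiffAt_const.congr_of_eventuallyEq h

/-- Away from the support of `F`, the solution satisfies the Helmholtz equation pointwise. -/
theorem weak_helmholtz_laplacian_eq {k : ℝ} {w F : E3 → ℂ} (hw : Continuous w)
    (hweak : ∀ φ : E3 → ℂ, ContDiff ℝ ∞ φ → HasCompactSupport φ →
      (∫ x, w x * (Δ φ x + (k : ℂ) ^ 2 * φ x)) + ∫ x, F x * φ x = 0)
    {S : Set E3} (hS : IsClosed S) (hF : ∀ᵐ x, x ∉ S → F x = 0) {x₀ : E3} (hx₀ : x₀ ∉ S) :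
    Δ w x₀ = -(k : ℂ) ^ 2 * w x₀ := by
  have hreg : ∀ x ∉ S, ContDiffAt ℝ ∞ w x := fun x hx => weak_helmholtz_contDiffAt hw hweak hS hF hx
  set q : E3 → ℂ := fun x => Δ w x + (k : ℂ) ^ 2 * w x with hq
  have hqc : ContinuousOn q Sᶜ := by
    intro x hx
    obtain ⟨χ, hχ, hχc, hχs, hχ1, -⟩ := exists_smooth_cutoff (isCompact_singleton (x := x))
      hS.isOpen_compl (Set.singleton_subset_iff.2 hx)
    have hXs : tsupport (fun y => (χ y : ℂ)) ⊆ Sᶜ :=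
      (tsupport_ofReal_subset χ).trans hχs
    have hd := contDiff_mul_of_tsupport (f := fun y => (χ y : ℂ)) (g := w)
      (Complex.ofRealCLM.contDiff.comp hχ) fun y hy => hreg y (hXs hy)
    have he : (fun y => (χ y : ℂ) * w y) =ᶠ[𝓝 x] w := by
      filter_upwards [hχ1 x rfl] with y hy
      simp [hy]
    have h1 : Continuous (Δ fun y => (χ y : ℂ) * w y) :=
      (hd.of_le ENat.LEInfty.out).continuous_laplacian
    have h2 : ContinuousAt (Δ w) x :=
      h1.continuousAt.congr (InnerProductSpace.laplacian_congr_nhds he)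
    exact (h2.add (continuousAt_const.mul hw.continuousAt)).continuousWithinAt
  have hae : ∀ᵐ x, x ∈ Sᶜ → q x = 0 := by
    refine hS.isOpen_compl.ae_eq_zero_of_integral_contDiff_smul_eq_zero
      (hqc.locallyIntegrableOn hS.isOpen_compl.measurableSet) fun φ hφ hφc hφs => ?_
    obtain ⟨χ, hχ, hχc, hχs, hχ1, -⟩ := exists_smooth_cutoff hφc hS.isOpen_compl hφs
    set W : E3 → ℂ := fun y => (χ y : ℂ) * w y with hW
    have hXs : tsupport (fun y => (χ y : ℂ)) ⊆ Sᶜ :=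
      (tsupport_ofReal_subset χ).trans hχs
    have hWd : ContDiff ℝ ∞ W := contDiff_mul_of_tsupport (f := fun y => (χ y : ℂ)) (g := w)
      (Complex.ofRealCLM.contDiff.comp hχ) fun y hy => hreg y (hXs hy)
    set f : E3 → ℂ := fun y => (φ y : ℂ) with hf
    have hfd : ContDiff ℝ ∞ f := Complex.ofRealCLM.contDiff.comp hφ
    have hfc : HasCompactSupport f := hφc.comp_left (g := fun t : ℝ => (t : ℂ)) rfl
    have hfs : tsupport f ⊆ tsupport φ := tsupport_ofReal_subset φ
    have he : ∀ y ∈ tsupport φ, W =ᶠ[𝓝 y] w := fun y hy => by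
      filter_upwards [hχ1 y hy] with z hz
      simp [hW, hz]
    have hg := integral_green_eq_zero (hfd.of_le ENat.LEInfty.out) (hWd.of_le ENat.LEInfty.out) hfc
    have hwk := hweak f hfd hfc
    have hF0 : ∫ y, F y * f y = 0 := by
      rw [← integral_zero E3 ℂ]
      refine integral_congr_ae ?_
      filter_upwards [hF] with y hy
      by_cases hyS : y ∈ S
      · have : f y = 0 := image_eq_zero_of_notMem_tsupport fun h => hφs (hfs h) hyS
        simp [this]
      · simp [hy hyS]
    rw [hF0, add_zero] at hwk
    have hΔf : Continuous (Δ f) := (hfd.of_le ENat.LEInfty.out).continuous_laplacian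
    have hΔW : Continuous (Δ W) := (hWd.of_le ENat.LEInfty.out).continuous_laplacian
    have hΔfc : HasCompactSupport (Δ f) := hfc.mono' fun y hy => by
      by_contra h; exact hy (laplacian_eq_zero_of_notMem_tsupport h)
    have i1 : Integrable fun y => f y * Δ W y - W y * Δ f y :=
      ((hfd.continuous.mul hΔW).sub (hWd.continuous.mul hΔf)).integrable_of_hasCompactSupport
        (HasCompactSupport.sub (f := fun y => f y * Δ W y) (f' := fun y => W y * Δ f y)
          hfc.mul_right hΔfc.mul_left)
    have i2 : Integrable fun y => w y * (Δ f y + (k : ℂ) ^ 2 * f y) := by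
      refine (hw.mul (hΔf.add (continuous_const.mul
        hfd.continuous))).integrable_of_hasCompactSupport (HasCompactSupport.mul_left ?_)
      exact hΔfc.add hfc.mul_left
    have hsum := integral_add i1 i2
    rw [hg, hwk, add_zero] at hsum
    rw [← hsum]
    refine integral_congr_ae (Eventually.of_forall fun y => ?_)
    by_cases hy : y ∈ tsupport φ
    · have h1 := (InnerProductSpace.laplacian_congr_nhds (he y hy)).eq_of_nhds
      have h2 := (he y hy).eq_of_nhds
      simp only [h1, h2, hq, Complex.real_smul]
      rw [show (φ y : ℂ) = f y from rfl]
      ring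
    · have h1 : f y = 0 := image_eq_zero_of_notMem_tsupport fun h => hy (hfs h)
      have h2 : Δ f y = 0 := laplacian_eq_zero_of_notMem_tsupport fun h => hy (hfs h)
      have h3 : φ y = 0 := image_eq_zero_of_notMem_tsupport hy
      simp [h1, h2, h3]
  have hzero : Set.EqOn q (fun _ => 0) Sᶜ := by
    refine Measure.eqOn_open_of_ae_eq (μ := volume) ?_ hS.isOpen_compl hqc continuousOn_const
    exact (ae_restrict_iff' hS.isOpen_compl.measurableSet).2 hae
  have h := hzero hx₀
  simp only [hq] at h
  rw [eq_neg_of_add_eq_zero_left h]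
  ring

/-! ### Radial cutoffs and the averaged flux through large spheres -/

theorem exists_deriv_smoothTransition_bound :
    ∃ B : ℝ, 0 ≤ B ∧ ∀ t, 0 ≤ deriv Real.smoothTransition t ∧ deriv Real.smoothTransition t ≤ B ∧
      (t ∉ Set.Icc (0 : ℝ) 1 → deriv Real.smoothTransition t = 0) := by
  have hz : ∀ t, t ∉ Set.Icc (0 : ℝ) 1 → deriv Real.smoothTransition t = 0 := by
    intro t ht
    rw [Set.mem_Icc, not_and_or, not_le, not_le] at ht
    rcases ht with h | h
    · have : Real.smoothTransition =ᶠ[𝓝 t] fun _ => 0 :=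
        (gt_mem_nhds h).mono fun s hs => Real.smoothTransition.zero_of_nonpos (le_of_lt hs)
      rw [this.deriv_eq, deriv_const]
    · have : Real.smoothTransition =ᶠ[𝓝 t] fun _ => 1 :=
        (lt_mem_nhds h).mono fun s hs => Real.smoothTransition.one_of_one_le (le_of_lt hs)
      rw [this.deriv_eq, deriv_const]
  have hc : Continuous (deriv Real.smoothTransition) :=
    (Real.smoothTransition.contDiff (n := 1)).continuous_deriv le_rfl
  obtain ⟨B, hB⟩ := hc.bounded_above_of_compact_support
    (HasCompactSupport.intro isCompact_Icc hz)
  exact ⟨B, (norm_nonneg _).trans (hB 0), fun t =>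
    ⟨Real.smoothTransition.monotone.deriv_nonneg, (le_abs_self _).trans (hB t), hz t⟩⟩

/-- A smooth radially decreasing cutoff, equal to `1` for `|y| ≤ R` and to `0` for `|y|² ≥ 2 R²`. -/
noncomputable def radialCutoff (R : ℝ) (y : E3) : ℝ :=
  Real.smoothTransition (2 - ‖y‖ ^ 2 / R ^ 2)

/-- The factor `b` in `∇ (radialCutoff R) y = - b(y) y`. -/
noncomputable def radialCutoffSlope (R : ℝ) (y : E3) : ℝ :=
  2 / R ^ 2 * deriv Real.smoothTransition (2 - ‖y‖ ^ 2 / R ^ 2)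

theorem contDiff_radialCutoff (R : ℝ) : ContDiff ℝ ∞ (radialCutoff R) := by
  have h : ContDiff ℝ ∞ fun y : E3 => 2 - ‖y‖ ^ 2 / R ^ 2 :=
    contDiff_const.sub (((contDiff_id (E := E3)).norm_sq ℝ).div_const _)
  exact (Real.smoothTransition.contDiff (n := ⊤)).comp h

theorem radialCutoff_eq_one {R : ℝ} (hR : 0 < R) {y : E3} (hy : ‖y‖ ≤ R) : radialCutoff R y = 1 := by
  apply Real.smoothTransition.one_of_one_le
  have : ‖y‖ ^ 2 / R ^ 2 ≤ 1 := by
    rw [div_le_one (by positivity)]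
    exact pow_le_pow_left₀ (norm_nonneg _) hy 2
  linarith

theorem hasCompactSupport_radialCutoff {R : ℝ} (hR : 0 < R) :
    HasCompactSupport (radialCutoff R) := by
  refine HasCompactSupport.intro (isCompact_closedBall (0 : E3) (2 * R)) fun y hy => ?_
  apply Real.smoothTransition.zero_of_nonpos
  rw [mem_closedBall_zero_iff, not_le] at hy
  have : 2 ≤ ‖y‖ ^ 2 / R ^ 2 := by
    rw [le_div_iff₀ (by positivity)]
    nlinarith
  linarith

theorem fderiv_radialCutoff (R : ℝ) (y v : E3) :
    fderiv ℝ (radialCutoff R) y v = -radialCutoffSlope R y * ⟪y, v⟫_ℝ := by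
  have h1 : HasFDerivAt (fun y : E3 => 2 - ‖y‖ ^ 2 / R ^ 2)
      (-((R ^ 2)⁻¹ • ((2 : ℝ) • innerSL ℝ y))) y := by
    have h0 : HasFDerivAt (fun y : E3 => ‖y‖ ^ 2) ((2 : ℝ) • innerSL ℝ y) y := by
      refine (hasFDerivAt_id y).norm_sq.congr_fderiv ?_
      ext v; simp
    have := (h0.const_mul (R ^ 2)⁻¹).const_sub 2
    refine this.congr_of_eventuallyEq (Eventually.of_forall fun z => ?_)
    simp only
    ring
  have h2 : HasDerivAt Real.smoothTransition
      (deriv Real.smoothTransition (2 - ‖y‖ ^ 2 / R ^ 2)) (2 - ‖y‖ ^ 2 / R ^ 2) :=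
    ((Real.smoothTransition.contDiff (n := 1)).differentiable (by simp) _).hasDerivAt
  have h3 : fderiv ℝ (radialCutoff R) y = _ := (h2.comp_hasFDerivAt y h1).fderiv
  rw [h3, radialCutoffSlope]
  simp
  ring

theorem continuous_radialCutoffSlope (R : ℝ) : Continuous (radialCutoffSlope R) := by
  have hc : Continuous (deriv Real.smoothTransition) :=
    (Real.smoothTransition.contDiff (n := 1)).continuous_deriv le_rfl
  unfold radialCutoffSlope
  fun_prop

theorem radialCutoffSlope_nonneg (R : ℝ) (y : E3) : 0 ≤ radialCutoffSlope R y := by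
  obtain ⟨B, -, hB⟩ := exists_deriv_smoothTransition_bound
  exact mul_nonneg (by positivity) (hB _).1

theorem radialCutoffSlope_eq_zero {R : ℝ} (hR : 0 < R) {y : E3} (hy : ¬(R ≤ ‖y‖ ∧ ‖y‖ ≤ 2 * R)) :
    radialCutoffSlope R y = 0 := by
  obtain ⟨B, -, hB⟩ := exists_deriv_smoothTransition_bound
  rw [radialCutoffSlope, (hB _).2.2, mul_zero]
  rintro ⟨h1, h2⟩
  have h3 : ‖y‖ ^ 2 / R ^ 2 ≤ 2 := by linarith
  have h4 : 1 ≤ ‖y‖ ^ 2 / R ^ 2 := by linarith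
  rw [div_le_iff₀ (by positivity)] at h3
  rw [le_div_iff₀ (by positivity)] at h4
  refine hy ⟨?_, ?_⟩
  · nlinarith [norm_nonneg y]
  · nlinarith [norm_nonneg y]

theorem hasCompactSupport_radialCutoffSlope {R : ℝ} (hR : 0 < R) :
    HasCompactSupport (radialCutoffSlope R) := by
  refine HasCompactSupport.intro (isCompact_closedBall (0 : E3) (2 * R)) fun y hy => ?_
  exact radialCutoffSlope_eq_zero hR fun h => hy (mem_closedBall_zero_iff.2 h.2)

/-- The slope is `O(R⁻²)` on a set of volume `O(R³)`. -/
theorem exists_integral_radialCutoffSlope_le :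
    ∃ c : ℝ, 0 ≤ c ∧ ∀ R, 0 < R → ∫ y, radialCutoffSlope R y ≤ c * R := by
  obtain ⟨B, hB0, hB⟩ := exists_deriv_smoothTransition_bound
  refine ⟨2 * B * (8 * volume.real (Metric.ball (0 : E3) 1)), by positivity, fun R hR => ?_⟩
  have h1 : ∫ y, radialCutoffSlope R y = ∫ y in Metric.closedBall 0 (2 * R),
      radialCutoffSlope R y := by
    refine (setIntegral_eq_integral_of_forall_compl_eq_zero fun y hy => ?_).symm
    exact radialCutoffSlope_eq_zero hR fun h => hy (mem_closedBall_zero_iff.2 h.2)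
  have h2 : ‖∫ y in Metric.closedBall (0 : E3) (2 * R), radialCutoffSlope R y‖
      ≤ 2 / R ^ 2 * B * volume.real (Metric.closedBall (0 : E3) (2 * R)) := by
    refine norm_setIntegral_le_of_norm_le_const measure_closedBall_lt_top fun y _ => ?_
    rw [Real.norm_of_nonneg (radialCutoffSlope_nonneg R y), radialCutoffSlope]
    exact mul_le_mul_of_nonneg_left (hB _).2.1 (by positivity)
  rw [h1]
  refine (le_abs_self _).trans (h2.trans (le_of_eq ?_))
  rw [measureReal_def, Measure.addHaar_closedBall volume (0 : E3) (by positivity),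
    finrank_euclideanSpace_fin, ENNReal.toReal_mul, ENNReal.toReal_ofReal (by positivity),
    ← measureReal_def]
  field_simp
  ring

/-- The flux of `u ∇v - v ∇u` through a large sphere, averaged over the radius, does not depend on
the radius if `u` and `v` solve the same Helmholtz equation near infinity. -/
theorem integral_green_eq_flux {u v : E3 → ℂ} (hu : ContDiff ℝ 2 u) (hv : ContDiff ℝ 2 v)
    {R : ℝ} (hR : 0 < R) (h0 : ∀ y, R < ‖y‖ → u y * Δ v y - v y * Δ u y = 0) :
    ∫ y, (u y * Δ v y - v y * Δ u y) =
      ∫ y, (radialCutoffSlope R y : ℂ) * (u y * fderiv ℝ v y y - v y * fderiv ℝ u y y) := by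
  have h := integral_cutoff_mul_green hu hv ((contDiff_radialCutoff R).of_le (by simp))
    (hasCompactSupport_radialCutoff hR)
  have h1 : ∀ y, (radialCutoff R y : ℂ) * (u y * Δ v y - v y * Δ u y) =
      u y * Δ v y - v y * Δ u y := by
    intro y
    by_cases hy : R < ‖y‖
    · rw [h0 y hy, mul_zero]
    · rw [radialCutoff_eq_one hR (not_lt.1 hy)]; simp
  simp_rw [h1] at h
  rw [h, ← integral_neg]
  refine integral_congr_ae (Eventually.of_forall fun y => ?_)
  have hl : ∀ ℓ : E3 →L[ℝ] ℂ, ℓ y = ∑ i, (y i : ℂ) * ℓ (stdVec i) := fun ℓ => by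
    have hy : y = ∑ i, y i • stdVec i := by
      have := (EuclideanSpace.basisFun (Fin 3) ℝ).sum_repr y
      simpa using this.symm
    conv_lhs => rw [hy]
    simp only [map_sum, map_smul, Complex.real_smul]
  simp only [fderiv_radialCutoff, greenField, inner_stdVec]
  rw [hl (fderiv ℝ v y), hl (fderiv ℝ u y)]
  simp only [Fin.sum_univ_three]
  push_cast
  ring

/-! ### Outgoing solutions have no flux at infinity -/

theorem continuous_fderiv_apply_self {v : E3 → ℂ} (hv : ContDiff ℝ 2 v) :
    Continuous fun y => fderiv ℝ v y y :=
  (hv.continuous_fderiv two_ne_zero).clm_apply continuous_id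

theorem integrable_radialCutoffSlope_mul {R : ℝ} (hR : 0 < R) {f : E3 → ℝ} (hf : Continuous f) :
    Integrable fun y => radialCutoffSlope R y * f y :=
  ((continuous_radialCutoffSlope R).mul hf).integrable_of_hasCompactSupport
    (hasCompactSupport_radialCutoffSlope hR).mul_right

/-- Conservation of the energy flux bounds the mean square of an outgoing solution over large
spheres. -/
theorem exists_integral_radialCutoffSlope_norm_sq_le {k : ℝ} (hk : 0 < k) {v : E3 → ℂ}
    (hv : ContDiff ℝ 2 v) {R₀ : ℝ} (hR₀ : 0 < R₀)
    (hΔ : ∀ y, R₀ < ‖y‖ → Δ v y = -(k : ℂ) ^ 2 * v y)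
    (hE : ∀ y, R₀ < ‖y‖ → ‖fderiv ℝ v y y - Complex.I * k * ‖y‖ * v y‖ ≤ 1) :
    ∃ A, ∀ R, R₀ < R → ∫ y, radialCutoffSlope R y * (‖y‖ * ‖v y‖ ^ 2) ≤ A := by
  obtain ⟨c, hc0, hc⟩ := exists_integral_radialCutoffSlope_le
  set u : E3 → ℂ := Complex.conjCLE ∘ v with hu
  have hud : ContDiff ℝ 2 u := Complex.conjCLE.contDiff.comp hv
  have hufd : ∀ y d, fderiv ℝ u y d = (starRingEnd ℂ) (fderiv ℝ v y d) := fun y d => by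
    rw [hu, ContinuousLinearEquiv.comp_fderiv]; rfl
  have huΔ : ∀ y, Δ u y = (starRingEnd ℂ) (Δ v y) := fun y => by
    rw [hu, InnerProductSpace.laplacian_CLE_comp_left]; rfl
  set q : E3 → ℝ := fun y => ((starRingEnd ℂ) (v y) * fderiv ℝ v y y).im with hq
  have hqc : Continuous q :=
    Complex.continuous_im.comp ((Complex.continuous_conj.comp hv.continuous).mul
      (continuous_fderiv_apply_self hv))
  set N : ℂ := ∫ y, (u y * Δ v y - v y * Δ u y) with hN
  -- The averaged energy flux, with `u` the complex conjugate of `v`.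
  have hflux : ∀ R, R₀ < R → ∫ y, radialCutoffSlope R y * q y = (N / (2 * Complex.I)).re := by
    intro R hR
    have h := integral_green_eq_flux hud hv (hR₀.trans hR) fun y hy => by
      rw [huΔ, hΔ y (hR.trans hy)]
      simp [hu]
      ring
    have h1 : ∀ y, (radialCutoffSlope R y : ℂ) * (u y * fderiv ℝ v y y - v y * fderiv ℝ u y y)
        = 2 * Complex.I * ((radialCutoffSlope R y * q y : ℝ) : ℂ) := by
      intro y
      have h2 := Complex.sub_conj ((starRingEnd ℂ) (v y) * fderiv ℝ v y y)
      rw [map_mul, Complex.conj_conj] at h2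
      rw [hufd, show u y = (starRingEnd ℂ) (v y) from rfl, h2]
      push_cast
      ring
    simp_rw [h1] at h
    rw [integral_const_mul] at h
    rw [hN, h, mul_div_cancel_left₀ _ (by simp)]
    rw [show ∫ y, ((radialCutoffSlope R y * q y : ℝ) : ℂ) =
      ((∫ y, radialCutoffSlope R y * q y : ℝ) : ℂ) from integral_ofReal]
    rw [Complex.ofReal_re]
  refine ⟨2 / k * ((N / (2 * Complex.I)).re + c / (2 * k)), fun R hR => ?_⟩
  have hRpos : 0 < R := hR₀.trans hR
  have hpt : ∀ y, k / 2 * (radialCutoffSlope R y * (‖y‖ * ‖v y‖ ^ 2)) ≤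
      radialCutoffSlope R y * q y + 1 / (2 * k * R) * radialCutoffSlope R y := by
    intro y
    by_cases hy : R ≤ ‖y‖ ∧ ‖y‖ ≤ 2 * R
    · have hb := radialCutoffSlope_nonneg R y
      have hyR : R₀ < ‖y‖ := hR.trans_le hy.1
      have hE1 := hE y hyR
      set E := fderiv ℝ v y y - Complex.I * k * ‖y‖ * v y with hEd
      have hD : fderiv ℝ v y y = E + Complex.I * k * ‖y‖ * v y := by rw [hEd]; ring
      have hqy : q y = k * ‖y‖ * ‖v y‖ ^ 2 + ((starRingEnd ℂ) (v y) * E).im := by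
        simp only [hq]
        rw [hD, mul_add, Complex.add_im, add_comm]
        congr 1
        rw [show (starRingEnd ℂ) (v y) * (Complex.I * k * ‖y‖ * v y) =
          Complex.I * k * ‖y‖ * (v y * (starRingEnd ℂ) (v y)) by ring, Complex.mul_conj,
          Complex.normSq_eq_norm_sq]
        rw [show Complex.I * k * ‖y‖ * ((‖v y‖ ^ 2 : ℝ) : ℂ) =
          ((k * ‖y‖ * ‖v y‖ ^ 2 : ℝ) : ℂ) * Complex.I by push_cast; ring]
        simp only [Complex.im_ofReal_mul, Complex.I_im, mul_one]
      have hEim : -‖v y‖ ≤ ((starRingEnd ℂ) (v y) * E).im := by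
        have h1 := Complex.abs_im_le_norm ((starRingEnd ℂ) (v y) * E)
        rw [norm_mul, Complex.norm_conj] at h1
        have h2 : ‖v y‖ * ‖E‖ ≤ ‖v y‖ := mul_le_of_le_one_right (norm_nonneg _) hE1
        exact (abs_le.1 (h1.trans h2)).1
      -- The arithmetic-geometric mean inequality absorbs the linear term.
      have hamgm : ‖v y‖ ≤ k / 2 * (‖y‖ * ‖v y‖ ^ 2) + 1 / (2 * k * R) := by
        have h1 : k / 2 * (R * ‖v y‖ ^ 2) ≤ k / 2 * (‖y‖ * ‖v y‖ ^ 2) := by gcongr; exact hy.1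
        have h2 : k / 2 * (R * ‖v y‖ ^ 2) + 1 / (2 * k * R) - ‖v y‖
            = (k * R * ‖v y‖ - 1) ^ 2 / (2 * k * R) := by field_simp; ring
        have h3 : 0 ≤ (k * R * ‖v y‖ - 1) ^ 2 / (2 * k * R) := by positivity
        linarith
      have : k / 2 * (‖y‖ * ‖v y‖ ^ 2) ≤ q y + 1 / (2 * k * R) := by rw [hqy]; linarith
      nlinarith
    · rw [radialCutoffSlope_eq_zero hRpos hy]; simp
  have hi1 := integrable_radialCutoffSlope_mul hRpos
    (continuous_norm.mul ((continuous_norm.comp hv.continuous).pow 2))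
  have hi2 := integrable_radialCutoffSlope_mul hRpos hqc
  have hi3 : Integrable (radialCutoffSlope R) :=
    (continuous_radialCutoffSlope R).integrable_of_hasCompactSupport
      (hasCompactSupport_radialCutoffSlope hRpos)
  have h := integral_mono (hi1.const_mul (k / 2)) (hi2.add (hi3.const_mul _)) hpt
  simp only [Pi.add_apply] at h
  rw [integral_const_mul, integral_add hi2 (hi3.const_mul _), integral_const_mul,
    hflux R hR] at h
  have h4 : 1 / (2 * k * R) * ∫ y, radialCutoffSlope R y ≤ c / (2 * k) := by
    calc _ ≤ 1 / (2 * k * R) * (c * R) := by gcongr; exact hc R hRpos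
      _ = c / (2 * k) := by field_simp
  have h5 : k / 2 * ∫ y, radialCutoffSlope R y * (‖y‖ * ‖v y‖ ^ 2) ≤
      (N / (2 * Complex.I)).re + c / (2 * k) := by
    refine h.trans ?_
    gcongr
  calc _ = 2 / k * (k / 2 * ∫ y, radialCutoffSlope R y * (‖y‖ * ‖v y‖ ^ 2)) := by field_simp
    _ ≤ _ := by gcongr

/-- Two outgoing solutions of the Helmholtz equation have no flux at infinity. -/
theorem integral_green_eq_zero_of_outgoing {k : ℝ} (hk : 0 < k) {v κ : E3 → ℂ}
    (hv : ContDiff ℝ 2 v) (hκ : ContDiff ℝ 2 κ) {R₀ : ℝ} (hR₀ : 0 < R₀)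
    (hΔv : ∀ y, R₀ < ‖y‖ → Δ v y = -(k : ℂ) ^ 2 * v y)
    (hΔκ : ∀ y, R₀ < ‖y‖ → Δ κ y = -(k : ℂ) ^ 2 * κ y)
    (hE : Tendsto (fun y => fderiv ℝ v y y - Complex.I * k * ‖y‖ * v y)
      (Bornology.cobounded E3) (𝓝 0))
    {C : ℝ} (hC : 0 ≤ C) (hκ1 : ∀ y, R₀ < ‖y‖ → ‖κ y‖ ≤ C / ‖y‖)
    (hκ2 : ∀ y, R₀ < ‖y‖ → ‖fderiv ℝ κ y y - Complex.I * k * ‖y‖ * κ y‖ ≤ C / ‖y‖) :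
    ∫ y, (v y * Δ κ y - κ y * Δ v y) = 0 := by
  have hEs : ∀ s : ℝ, 0 < s → ∃ r, R₀ ≤ r ∧ ∀ y, r < ‖y‖ →
      ‖fderiv ℝ v y y - Complex.I * k * ‖y‖ * v y‖ ≤ s := by
    intro s hs
    have h := (Metric.tendsto_nhds.1 hE) s hs
    obtain ⟨r, -, hr⟩ := (hasBasis_cobounded_norm (E := E3)).eventually_iff.1 h
    refine ⟨max R₀ r, le_max_left _ _, fun y hy => ?_⟩
    have := hr (show y ∈ {x : E3 | r ≤ ‖x‖} from (le_max_right _ _).trans hy.le)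
    rw [dist_zero_right] at this
    exact this.le
  obtain ⟨c, hc0, hc⟩ := exists_integral_radialCutoffSlope_le
  obtain ⟨r₁, hr₁, hE1⟩ := hEs 1 one_pos
  obtain ⟨A, hA⟩ := exists_integral_radialCutoffSlope_norm_sq_le hk hv (hR₀.trans_le hr₁)
    (fun y hy => hΔv y (hr₁.trans_lt hy)) hE1
  set M := ∫ y, (v y * Δ κ y - κ y * Δ v y) with hM
  have hbound : ∀ s : ℝ, 0 < s → ∀ᶠ R : ℝ in atTop,
      ‖M‖ ≤ (C / 2 * |A| + C / 2 * c) / R + C * s * c := by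
    intro s hs
    obtain ⟨r₂, hr₂, hE2⟩ := hEs s hs
    filter_upwards [eventually_gt_atTop (max r₁ r₂), eventually_ge_atTop 1] with R hR hR1
    have hRr₁ : r₁ < R := (le_max_left _ _).trans_lt hR
    have hRr₂ : r₂ < R := (le_max_right _ _).trans_lt hR
    have hRR₀ : R₀ < R := hr₁.trans_lt hRr₁
    have hRpos : 0 < R := hR₀.trans hRR₀
    have hflux := integral_green_eq_flux hv hκ hRpos fun y hy => by
      rw [hΔv y (hRR₀.trans hy), hΔκ y (hRR₀.trans hy)]; ring
    rw [hM, hflux]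
    have hi1 := integrable_radialCutoffSlope_mul hRpos
      (continuous_norm.mul ((continuous_norm.comp hv.continuous).pow 2))
    have hi3 : Integrable (radialCutoffSlope R) :=
      (continuous_radialCutoffSlope R).integrable_of_hasCompactSupport
        (hasCompactSupport_radialCutoffSlope hRpos)
    have hpt : ∀ y, ‖(radialCutoffSlope R y : ℂ) * (v y * fderiv ℝ κ y y - κ y * fderiv ℝ v y y)‖ ≤
        C / (2 * R) * (radialCutoffSlope R y * (‖y‖ * ‖v y‖ ^ 2))
          + (C / (2 * R ^ 2) + C * s / R) * radialCutoffSlope R y := by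
      intro y
      by_cases hy : R ≤ ‖y‖ ∧ ‖y‖ ≤ 2 * R
      · have hb := radialCutoffSlope_nonneg R y
        have hyR : R₀ < ‖y‖ := hRR₀.trans_le hy.1
        have hypos : 0 < ‖y‖ := hR₀.trans hyR
        have hEv := hE2 y (hRr₂.trans_le hy.1)
        have hκ1y := hκ1 y hyR
        have hκ2y := hκ2 y hyR
        set E := fderiv ℝ v y y - Complex.I * k * ‖y‖ * v y with hEd
        set E' := fderiv ℝ κ y y - Complex.I * k * ‖y‖ * κ y with hEd'
        have hsplit : v y * fderiv ℝ κ y y - κ y * fderiv ℝ v y y = v y * E' - κ y * E := by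
          rw [hEd, hEd']; ring
        have hCR : C / ‖y‖ ≤ C / R := by gcongr; exact hy.1
        have h1 : ‖v y‖ * (C / ‖y‖) ≤ C / (2 * R) * (‖y‖ * ‖v y‖ ^ 2) + C / (2 * R ^ 2) := by
          have e1 : ‖v y‖ * (C / ‖y‖) ≤ ‖v y‖ * (C / R) := by gcongr
          have e2 : C / (2 * R) * (R * ‖v y‖ ^ 2) ≤ C / (2 * R) * (‖y‖ * ‖v y‖ ^ 2) := by
            gcongr; exact hy.1
          have e3 : C / (2 * R) * (R * ‖v y‖ ^ 2) + C / (2 * R ^ 2) - ‖v y‖ * (C / R)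
              = C / 2 * (‖v y‖ - 1 / R) ^ 2 := by field_simp; ring
          have e4 : 0 ≤ C / 2 * (‖v y‖ - 1 / R) ^ 2 := by positivity
          linarith
        have h2 : ‖κ y‖ * ‖E‖ ≤ C * s / R := by
          calc ‖κ y‖ * ‖E‖ ≤ C / R * s :=
                mul_le_mul (hκ1y.trans hCR) hEv (norm_nonneg _) (by positivity)
            _ = C * s / R := by ring
        have h3 : ‖v y * E' - κ y * E‖ ≤
            C / (2 * R) * (‖y‖ * ‖v y‖ ^ 2) + (C / (2 * R ^ 2) + C * s / R) := by
          refine (norm_sub_le _ _).trans ?_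
          rw [norm_mul, norm_mul]
          have : ‖v y‖ * ‖E'‖ ≤ ‖v y‖ * (C / ‖y‖) := by gcongr
          linarith
        rw [norm_mul, Complex.norm_real, Real.norm_of_nonneg hb, hsplit]
        calc _ ≤ radialCutoffSlope R y *
              (C / (2 * R) * (‖y‖ * ‖v y‖ ^ 2) + (C / (2 * R ^ 2) + C * s / R)) := by gcongr
          _ = _ := by ring
      · rw [radialCutoffSlope_eq_zero hRpos hy]; simp
    have h := norm_integral_le_of_norm_le ((hi1.const_mul _).add (hi3.const_mul _))
      (Eventually.of_forall hpt)
    simp only [Pi.add_apply] at h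
    rw [integral_add (hi1.const_mul _) (hi3.const_mul _), integral_const_mul,
      integral_const_mul] at h
    refine h.trans ?_
    calc _ ≤ C / (2 * R) * |A| + (C / (2 * R ^ 2) + C * s / R) * (c * R) := by
          gcongr
          · exact (hA R hRr₁).trans (le_abs_self A)
          · exact hc R hRpos
      _ = _ := by field_simp; ring
  -- First `R → ∞`, then `s → 0`.
  have hle : ∀ s : ℝ, 0 < s → ‖M‖ ≤ 0 + C * s * c := fun s hs =>
    ge_of_tendsto ((tendsto_const_nhds.div_atTop tendsto_id).add tendsto_const_nhds) (hbound s hs)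
  have hlim : Tendsto (fun s : ℝ => 0 + C * s * c) (𝓝[>] 0) (𝓝 0) := by
    have : Continuous fun s : ℝ => 0 + C * s * c := by fun_prop
    simpa using (this.tendsto 0).mono_left (nhdsWithin_le_nhds (s := Set.Ioi 0))
  exact norm_le_zero_iff.1 (ge_of_tendsto hlim (eventually_nhdsWithin_of_forall hle))

/-- Bounds for the fundamental solution with a fixed pole at large distances. -/
theorem helmholtzKernel_far_bounds {k : ℝ} (hk : 0 < k) {x y : E3} (hy : 2 * ‖x‖ < ‖y‖) :
    ‖helmholtzKernel k (y - x)‖ ≤ 1 / ‖y‖ ∧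
      ‖fderiv ℝ (fun z => helmholtzKernel k (z - x)) y y
        - Complex.I * k * ‖y‖ * helmholtzKernel k (y - x)‖ ≤ (2 * k * ‖x‖ + 2) / ‖y‖ := by
  have hypos : 0 < ‖y‖ := (by positivity : 0 ≤ 2 * ‖x‖).trans_lt hy
  set ρ := ‖y - x‖ with hρ
  have h1 : ‖y‖ ≤ ρ + ‖x‖ := by
    calc ‖y‖ = ‖(y - x) + x‖ := by rw [sub_add_cancel]
      _ ≤ _ := norm_add_le _ _
  have h2 : ρ ≤ ‖y‖ + ‖x‖ := norm_sub_le _ _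
  have hρy : ‖y‖ / 2 ≤ ρ := by linarith
  have hρpos : 0 < ρ := by linarith
  have hne : y ≠ x := fun h => by rw [hρ, h] at hρpos; simp at hρpos
  have hK : ‖helmholtzKernel k (y - x)‖ = 1 / (4 * Real.pi * ρ) := by
    rw [helmholtzKernel, norm_mul, norm_div, norm_div, ← hρ]
    have : ‖Complex.exp (Complex.I * k * ρ)‖ = 1 := by
      rw [show Complex.I * k * ρ = ((k * ρ : ℝ) : ℂ) * Complex.I by push_cast; ring]
      exact Complex.norm_exp_ofReal_mul_I _
    rw [this]
    simp [abs_of_pos Real.pi_pos, abs_of_pos hρpos]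
    ring
  have hK1 : ‖helmholtzKernel k (y - x)‖ ≤ 1 / ‖y‖ := by
    rw [hK]
    gcongr
    nlinarith [Real.pi_gt_three]
  refine ⟨hK1, ?_⟩
  have hin : ⟪y - x, y⟫_ℝ = ρ ^ 2 + ⟪y - x, x⟫_ℝ := by
    rw [hρ, ← real_inner_self_eq_norm_sq, ← inner_add_right, sub_add_cancel]
  have hcs : |⟪y - x, x⟫_ℝ| ≤ ρ * ‖x‖ := abs_real_inner_le_norm _ _
  have hcs' : |⟪y - x, y⟫_ℝ| ≤ ρ * ‖y‖ := abs_real_inner_le_norm _ _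
  have ha : |⟪y - x, y⟫_ℝ / ρ - ‖y‖| ≤ 2 * ‖x‖ := by
    have e1 : ⟪y - x, y⟫_ℝ / ρ - ‖y‖ = (ρ - ‖y‖) + ⟪y - x, x⟫_ℝ / ρ := by
      rw [hin]; field_simp; ring
    have e2 : |⟪y - x, x⟫_ℝ / ρ| ≤ ‖x‖ := by
      rw [abs_div, abs_of_pos hρpos, div_le_iff₀ hρpos]
      linarith
    have e3 : |ρ - ‖y‖| ≤ ‖x‖ := abs_le.2 ⟨by linarith, by linarith⟩
    rw [e1]
    exact (abs_add_le _ _).trans (by linarith)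
  have hb : |⟪y - x, y⟫_ℝ / ρ ^ 2| ≤ 2 := by
    rw [abs_div, abs_of_pos (pow_pos hρpos 2), div_le_iff₀ (pow_pos hρpos 2)]
    nlinarith
  have hd : fderiv ℝ (fun z => helmholtzKernel k (z - x)) y y
        - Complex.I * k * ‖y‖ * helmholtzKernel k (y - x) =
      helmholtzKernel k (y - x) * (Complex.I * k * ((⟪y - x, y⟫_ℝ / ρ - ‖y‖ : ℝ) : ℂ)
        - ((⟪y - x, y⟫_ℝ / ρ ^ 2 : ℝ) : ℂ)) := by
    rw [(hasFDerivAt_helmholtzKernel k hne).fderiv, ContinuousLinearMap.smulRight_apply,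
      innerSL_apply_apply, Complex.real_smul, ← hρ]
    push_cast
    ring
  rw [hd, norm_mul]
  have he : ‖Complex.I * k * ((⟪y - x, y⟫_ℝ / ρ - ‖y‖ : ℝ) : ℂ)
        - ((⟪y - x, y⟫_ℝ / ρ ^ 2 : ℝ) : ℂ)‖ ≤ 2 * k * ‖x‖ + 2 := by
    refine (norm_sub_le _ _).trans ?_
    rw [norm_mul, norm_mul, Complex.norm_I, one_mul, Complex.norm_real, Complex.norm_real,
      Complex.norm_real, Real.norm_of_nonneg hk.le, Real.norm_eq_abs, Real.norm_eq_abs]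
    have := mul_le_mul_of_nonneg_left ha hk.le
    linarith
  calc _ ≤ 1 / ‖y‖ * (2 * k * ‖x‖ + 2) := mul_le_mul hK1 he (norm_nonneg _) (by positivity)
    _ = _ := by ring

/-! ### The field produced by the Cauchy data on the boundary -/

/-- A smooth function that vanishes near `K` and equals `1` outside of `V`. -/
theorem exists_smooth_excision {K V : Set E3} (hK : IsCompact K) (hV : IsOpen V) (hKV : K ⊆ V) :
    ∃ f : E3 → ℂ, ContDiff ℝ ∞ f ∧ tsupport f ⊆ Kᶜ ∧ ∀ y ∉ V, f =ᶠ[𝓝 y] fun _ => 1 := by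
  obtain ⟨χ, hχ, -, hχV, hχ1, -⟩ := exists_smooth_cutoff hK hV hKV
  refine ⟨fun y => 1 - (χ y : ℂ), contDiff_const.sub (Complex.ofRealCLM.contDiff.comp hχ),
    fun y hy hyK => ?_, fun y hy => ?_⟩
  · refine (notMem_tsupport_iff_eventuallyEq.2 ?_) hy
    filter_upwards [hχ1 y hyK] with z hz
    simp [hz]
  · filter_upwards [notMem_tsupport_iff_eventuallyEq.1 fun h => hy (hχV h)] with z hz
    simp [hz]

/-- Green's identity with the Cauchy data of `w` and of the fundamental solution with pole `x`,
for any `C²` functions `u` and `κ` that have these data. -/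
theorem IsBoundedLipschitzDomain.integral_surfaceIntegrand {Ω : Set E3}
    (hΩ : IsBoundedLipschitzDomain Ω) {k : ℝ} {x : E3} {w u κ : E3 → ℂ} (hu : ContDiff ℝ 2 u)
    (hκ : ContDiff ℝ 2 κ) (huc : HasCompactSupport u)
    (h₁ : ∀ y ∈ frontier Ω, u y = w y ∧ normalDeriv Ω u y = normalDeriv Ω w y)
    (h₂ : ∀ y ∈ frontier Ω, κ =ᶠ[𝓝 y] fun z => helmholtzKernel k (z - x)) :
    Integrable (surfaceIntegrand k Ω w x) (surfaceMeasure Ω) ∧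
      ∫ y in Ω, (u y * Δ κ y - κ y * Δ u y) =
        ∫ y, surfaceIntegrand k Ω w x y ∂(surfaceMeasure Ω) := by
  have hae : (fun y => u y * normalDeriv Ω κ y - κ y * normalDeriv Ω u y)
      =ᵐ[surfaceMeasure Ω] surfaceIntegrand k Ω w x := by
    filter_upwards [ae_restrict_mem isClosed_frontier.measurableSet] with y hy
    have h3 : normalDeriv Ω κ y = normalDeriv Ω (fun z => helmholtzKernel k (z - x)) y := by
      rw [normalDeriv, normalDeriv, (h₂ y hy).fderiv_eq]
    rw [surfaceIntegrand, (h₁ y hy).1, (h₁ y hy).2, h3, (h₂ y hy).eq_of_nhds]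
  obtain ⟨hi, he⟩ := hΩ.green hu hκ huc
  exact ⟨hi.congr hae, he.trans (integral_congr_ae hae)⟩

theorem integrable_green {u v : E3 → ℂ} (hu : ContDiff ℝ 2 u) (hv : ContDiff ℝ 2 v)
    (huc : HasCompactSupport u) : Integrable fun y => u y * Δ v y - v y * Δ u y := by
  have hΔc : HasCompactSupport (Δ u) := huc.mono' fun y hy => by
    by_contra h; exact hy (laplacian_eq_zero_of_notMem_tsupport h)
  exact ((hu.continuous.mul hv.continuous_laplacian).sub
    (hv.continuous.mul hu.continuous_laplacian)).integrable_of_hasCompactSupport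
      (HasCompactSupport.sub (f := fun y => u y * Δ v y) (f' := fun y => v y * Δ u y)
        huc.mul_right hΔc.mul_left)

/-- Where `κ` agrees with the fundamental solution, Green's integrand is the negative of the
volume integrand. -/
theorem green_eq_neg_volumeIntegrand {k : ℝ} {x y : E3} (hxy : y ≠ x) {u κ : E3 → ℂ}
    (h : κ =ᶠ[𝓝 y] fun z => helmholtzKernel k (z - x)) :
    u y * Δ κ y - κ y * Δ u y = -volumeIntegrand k u x y := by
  rw [volumeIntegrand, (InnerProductSpace.laplacian_congr_nhds h).eq_of_nhds, h.eq_of_nhds,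
    laplacian_helmholtzKernel k hxy]
  ring

/-- The radiation condition makes the field `w'` vanish inside `Ω`. -/
theorem IsOutgoingSolution.integral_surfaceIntegrand_eq_zero {k : ℝ} (hk : 0 < k) {Ω S : Set E3}
    (hΩ : IsBoundedLipschitzDomain Ω) (hS : IsClosed S) (hSΩ : S ⊆ Ω) {F w : E3 → ℂ}
    (hFS : ∀ᵐ x, x ∉ S → F x = 0) (hw : IsOutgoingSolution k F w) {x : E3} {κ : E3 → ℂ}
    (hκ : ContDiff ℝ 2 κ) (hκK : ∀ y ∉ Ω, κ =ᶠ[𝓝 y] fun z => helmholtzKernel k (z - x))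
    (hx : x ∈ Ω) : ∫ y, surfaceIntegrand k Ω w x y ∂(surfaceMeasure Ω) = 0 := by
  have hne : ∀ y ∉ Ω, y ≠ x := fun y hy h => hy (h ▸ hx)
  have hfr : ∀ y ∈ frontier Ω, y ∉ Ω := fun y hy h => by
    rw [hΩ.isOpen.frontier_eq] at hy; exact hy.2 h
  have hcl : IsCompact (closure Ω) := hΩ.isBounded.isCompact_closure
  have hSc : IsCompact S := hcl.of_isClosed_subset hS (hSΩ.trans subset_closure)
  obtain ⟨f, hf, hfS, hf1⟩ := exists_smooth_excision hSc hΩ.isOpen hSΩ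
  set W : E3 → ℂ := fun y => f y * w y with hW
  have hWd : ContDiff ℝ 2 W := (contDiff_mul_of_tsupport hf fun y hy =>
    weak_helmholtz_contDiffAt hw.continuous hw.weak_eq hS hFS (hfS hy)).of_le ENat.LEInfty.out
  have hWw : ∀ y ∉ Ω, W =ᶠ[𝓝 y] w := fun y hy => by
    filter_upwards [hf1 y hy] with z hz
    simp [hW, hz]
  have hΔW : ∀ y ∉ Ω, Δ W y = -(k : ℂ) ^ 2 * W y := fun y hy => by
    rw [(InnerProductSpace.laplacian_congr_nhds (hWw y hy)).eq_of_nhds, (hWw y hy).eq_of_nhds]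
    exact weak_helmholtz_laplacian_eq hw.continuous hw.weak_eq hS hFS fun h => hy (hSΩ h)
  have hΔκ : ∀ y ∉ Ω, Δ κ y = -(k : ℂ) ^ 2 * κ y := fun y hy => by
    rw [(InnerProductSpace.laplacian_congr_nhds (hκK y hy)).eq_of_nhds, (hκK y hy).eq_of_nhds]
    exact laplacian_helmholtzKernel k (hne y hy)
  obtain ⟨r, hr⟩ := hΩ.isBounded.exists_norm_le
  set R₀ := max (max r (2 * ‖x‖)) 1 with hR₀
  have hfar : ∀ y, R₀ < ‖y‖ → y ∉ Ω := fun y hy h =>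
    absurd (hr y h) (not_le.2 (((le_max_left _ _).trans (le_max_left _ _)).trans_lt hy))
  have hfar2 : ∀ y : E3, R₀ < ‖y‖ → 2 * ‖x‖ < ‖y‖ := fun y hy =>
    ((le_max_right _ _).trans (le_max_left _ _)).trans_lt hy
  have hR₀pos : 0 < R₀ := one_pos.trans_le (le_max_right _ _)
  have hrad : Tendsto (fun y => fderiv ℝ W y y - Complex.I * k * ‖y‖ * W y)
      (Bornology.cobounded E3) (𝓝 0) := by
    refine hw.radiation.congr' ?_
    filter_upwards [(tendsto_norm_cobounded_atTop (E := E3)).eventually_gt_atTop R₀] with y hy'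
    have hyC : (‖y‖ : ℂ) ≠ 0 := by exact_mod_cast (hR₀pos.trans hy').ne'
    rw [(hWw y (hfar y hy')).fderiv_eq, (hWw y (hfar y hy')).eq_of_nhds, map_smul,
      Complex.real_smul]
    push_cast
    field_simp
  have hC : 0 ≤ 2 * k * ‖x‖ + 2 := by positivity
  have h0 : ∫ y, (W y * Δ κ y - κ y * Δ W y) = 0 := by
    refine integral_green_eq_zero_of_outgoing hk hWd hκ hR₀pos (fun y hy => hΔW y (hfar y hy))
      (fun y hy => hΔκ y (hfar y hy)) hrad hC (fun y hy => ?_) (fun y hy => ?_)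
    · rw [(hκK y (hfar y hy)).eq_of_nhds]
      refine (helmholtzKernel_far_bounds hk (hfar2 y hy)).1.trans ?_
      gcongr
      have : 0 ≤ 2 * k * ‖x‖ := by positivity
      linarith
    · rw [(hκK y (hfar y hy)).eq_of_nhds, (hκK y (hfar y hy)).fderiv_eq]
      exact (helmholtzKernel_far_bounds hk (hfar2 y hy)).2
  -- Outside of `Ω` the integrand of `h0` vanishes, and inside it is that of Green's identity for a
  -- compactly supported function.
  obtain ⟨χ, hχ, hχc, -, hχ1, -⟩ := exists_smooth_cutoff hcl isOpen_univ (Set.subset_univ _)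
  set U : E3 → ℂ := fun y => (χ y : ℂ) * W y with hU
  have hUW : ∀ y ∈ closure Ω, U =ᶠ[𝓝 y] W := fun y hy => by
    filter_upwards [hχ1 y hy] with z hz
    simp [hU, hz]
  have hUd : ContDiff ℝ 2 U := (Complex.ofRealCLM.contDiff.comp (hχ.of_le ENat.LEInfty.out)).mul hWd
  have hUc : HasCompactSupport U :=
    (hχc.comp_left (g := fun t : ℝ => (t : ℂ)) rfl).mul_right
  have hUw : ∀ y ∈ frontier Ω, U =ᶠ[𝓝 y] w := fun y hy =>
    (hUW y (frontier_subset_closure hy)).trans (hWw y (hfr y hy))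
  rw [← (hΩ.integral_surfaceIntegrand hUd hκ hUc (fun y hy => ⟨(hUw y hy).eq_of_nhds, by
    rw [normalDeriv, normalDeriv, (hUw y hy).fderiv_eq]⟩) fun y hy => hκK y (hfr y hy)).2]
  have hout : ∀ y ∉ Ω, W y * Δ κ y - κ y * Δ W y = 0 := fun y hy => by
    rw [hΔW y hy, hΔκ y hy]
    ring
  rw [← setIntegral_eq_integral_of_forall_compl_eq_zero hout] at h0
  rw [← h0]
  refine setIntegral_congr_fun hΩ.isOpen.measurableSet fun y hy => ?_
  have h := hUW y (subset_closure hy)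
  simp only [h.eq_of_nhds, (InnerProductSpace.laplacian_congr_nhds h).eq_of_nhds]

theorem proposition4p1 (k : ℝ) (hk : 0 < k) (Ω D : Set E3)
    (hΩ : IsBoundedLipschitzDomain Ω) (hD : IsOpen D) (hDΩ : closure D ⊆ Ω)
    (F w : E3 → ℂ) (hF : MemLp F 2 volume) (hFD : ∀ᵐ x, x ∉ closure D → F x = 0)
    (hw : IsOutgoingSolution k F w)
    (Ψ : E3 → ℂ) (hΨ : ContDiff ℝ 2 Ψ) (hΨc : HasCompactSupport Ψ)
    (hΨw : ∀ y ∈ frontier Ω, Ψ y = w y ∧ normalDeriv Ω Ψ y = normalDeriv Ω w y) :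
    (∀ x ∈ Ω, Integrable (surfaceIntegrand k Ω w x) (surfaceMeasure Ω) ∧
      IntegrableOn (volumeIntegrand k Ψ x) Ωᶜ ∧
      cancellingField k Ω w x = ∫ y in Ωᶜ, volumeIntegrand k Ψ x y) ∧
    (∀ x ∉ closure Ω, Integrable (surfaceIntegrand k Ω w x) (surfaceMeasure Ω) ∧
      IntegrableOn (volumeIntegrand k Ψ x) Ω ∧
      cancellingField k Ω w x = ∫ y in Ω, volumeIntegrand k Ψ x y) := by
  have hΩm : MeasurableSet Ω := hΩ.isOpen.measurableSet
  have hfr : ∀ y ∈ frontier Ω, y ∉ Ω := fun y hy h => by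
    rw [hΩ.isOpen.frontier_eq] at hy; exact hy.2 h
  constructor
  · intro x hx
    have hne : ∀ y ∉ Ω, y ≠ x := fun y hy h => hy (h ▸ hx)
    -- The pole is removed inside `Ω`, which does not affect the Cauchy data on the boundary.
    obtain ⟨f, hf, hfx, hf1⟩ := exists_smooth_excision isCompact_singleton hΩ.isOpen
      (Set.singleton_subset_iff.2 hx)
    set κ : E3 → ℂ := fun y => f y * helmholtzKernel k (y - x) with hκ
    have hκd : ContDiff ℝ 2 κ := contDiff_mul_of_tsupport (hf.of_le ENat.LEInfty.out) fun y hy =>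
      contDiffAt_helmholtzKernel k (hfx hy)
    have hκK : ∀ y ∉ Ω, κ =ᶠ[𝓝 y] fun z => helmholtzKernel k (z - x) := fun y hy => by
      filter_upwards [hf1 y hy] with z hz
      simp [hκ, hz]
    obtain ⟨hi, he⟩ := hΩ.integral_surfaceIntegrand hΨ hκd hΨc hΨw fun y hy => hκK y (hfr y hy)
    have hzero := hw.integral_surfaceIntegrand_eq_zero hk hΩ isClosed_closure hDΩ hFD hκd hκK hx
    have hgi := integrable_green hΨ hκd hΨc
    have hvol : ∀ y ∈ Ωᶜ, Ψ y * Δ κ y - κ y * Δ Ψ y = -volumeIntegrand k Ψ x y := fun y hy =>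
      green_eq_neg_volumeIntegrand (hne y hy) (hκK y hy)
    refine ⟨hi, ?_, ?_⟩
    · refine (hgi.neg.integrableOn (s := Ωᶜ)).congr_fun (fun y hy => ?_) hΩm.compl
      simp only [Pi.neg_apply, hvol y hy, neg_neg]
    · have hsum := integral_add_compl hΩm hgi
      rw [he, hzero, zero_add, integral_green_eq_zero hΨ hκd hΨc,
        setIntegral_congr_fun hΩm.compl hvol, integral_neg, neg_eq_zero] at hsum
      rw [cancellingField, hzero, neg_zero, hsum]
  · intro x hx
    have hcl : IsCompact (closure Ω) := hΩ.isBounded.isCompact_closure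
    -- The pole is removed outside of `Ω`.
    obtain ⟨χ, hχ, -, hχx, hχ1, -⟩ := exists_smooth_cutoff hcl isOpen_compl_singleton
      (Set.subset_compl_singleton_iff.2 hx)
    set κ : E3 → ℂ := fun y => (χ y : ℂ) * helmholtzKernel k (y - x) with hκ
    have hκd : ContDiff ℝ 2 κ := contDiff_mul_of_tsupport
      (Complex.ofRealCLM.contDiff.comp (hχ.of_le ENat.LEInfty.out)) fun y hy =>
        contDiffAt_helmholtzKernel k (hχx (tsupport_ofReal_subset χ hy))
    have hκK : ∀ y ∈ closure Ω, κ =ᶠ[𝓝 y] fun z => helmholtzKernel k (z - x) := fun y hy => by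
      filter_upwards [hχ1 y hy] with z hz
      simp [hκ, hz]
    obtain ⟨hi, he⟩ := hΩ.integral_surfaceIntegrand hΨ hκd hΨc hΨw fun y hy =>
      hκK y (frontier_subset_closure hy)
    have hgi := integrable_green hΨ hκd hΨc
    have hvol : ∀ y ∈ Ω, Ψ y * Δ κ y - κ y * Δ Ψ y = -volumeIntegrand k Ψ x y := fun y hy =>
      green_eq_neg_volumeIntegrand (fun h : y = x => hx (h ▸ subset_closure hy))
        (hκK y (subset_closure hy))
    refine ⟨hi, ?_, ?_⟩
    · refine (hgi.neg.integrableOn (s := Ω)).congr_fun (fun y hy => ?_) hΩm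
      simp only [Pi.neg_apply, hvol y hy, neg_neg]
    · rw [cancellingField, ← he, setIntegral_congr_fun hΩm hvol, integral_neg, neg_neg]
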